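/- Let $A$ be a commutative complex Banach algebra (not necessarily unital) and let $M$ be a symmetric Banach $A$-bimodule, i.e. a complex Banach space with bounded bilinear, associative and commuting left and right actions of $A$ such that $am=ma$ for all $a\in A$, $m\in M$. For $n\ge 0$ let $C_n(A,M)=M\,\widehat\otimes\,A^{\widehat\otimes n}$ (projective tensor products), with the Hochschild boundary operators $d_n:C_{n+1}(A,M)\to C_n(A,M)$, $$d_n(m\otimes a_1\otimes\cdots\otimes a_{n+1})=ma_1\otimes a_2\otimes\cdots\otimes a_{n+1}+\sum_{j=1}^n(-1)^j m\otimes a_1\otimes\cdots\otimes a_ja_{j+1}\otimes\cdots\otimes a_{n+1}+(-1)^{n+1}a_{n+1}m\otimes a_1\otimes\cdots\otimes a_n,$$ and let $C^n(A,M)$ be the Banach space of bounded $n$-linear maps $A^n\to M$, with the Hochschild coboundary operators $\delta^n:C^n(A,M)\to C^{n+1}(A,M)$, $$\delta^n\psi(a_1,\dots,a_{n+1})=a_1\psi(a_2,\dots,a_{n+1})+\sum_{j=1}^n(-1)^j\psi(a_1,\dots,a_ja_{j+1},\dots,a_{n+1})+(-1)^{n+1}\psi(a_1,\dots,a_n)a_{n+1}.$$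 Let $s_n=\sum_{0<p<n}\sum_\sigma \operatorname{sgn}(\sigma)\,\sigma\in\mathbb Q S_n$, where the inner sum is over the $(p,n-p)$-shuffles $\sigma$ (the permutations that are increasing on $\{1,\dots,p\}$ and on $\{p+1,\dots,n\}$), and let $\lambda_k=2^k-2$. For $n\ge1$ the Barr–Gerstenhaber–Schack (Eulerian) idempotents are $$e_n(i)=\prod_{1\le k\le n,\ k\ne i}\frac{s_n-\lambda_k}{\lambda_i-\lambda_k}\in\mathbb Q S_n\quad(1\le i\le n),\qquad e_n(i)=0\ \text{ for all other } i\ge 0 ;$$ moreover $e_0(0)=1$ and $e_0(i)=0$ for $i\ge1$. The group $S_n$ acts on $A^{\widehat\otimes n}$ by moving the $k$-th tensor factor to position $\sigma(k)$. Let $P_n^i=\mathrm{id}_M\widehat\otimes e_n(i)$ on $C_n(A,M)$, and let $Q_n^i$ on $C^n(A,M)$ be pre-composition with $e_n(i)$. Put $I_n=\{1,\dots,n\}$ for $n\ge1$ and $I_0=\{0\}$. Then $(C_*(A,M),d)$ is a chain complex and $(C^*(A,M),\delta)$ is a cochain complex, and the following hold. 1. For each $i\ge0$, $P_*^i$ is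 a bounded chain projection on $C_*(A,M)$: each $P_n^i$ is a bounded linear map with $P_n^iP_n^i=P_n^i$, and $d_nP_{n+1}^i=P_n^id_n$ for all $n\ge 0$. Likewise $Q_*^i$ is a bounded chain projection on $C^*(A,M)$: $Q_n^iQ_n^i=Q_n^i$ and $\delta^nQ_n^i=Q_{n+1}^i\delta^n$ for all $n\ge 0$. 2. For each $n\ge 0$: $P_n^iP_n^j=0$ for $i\ne j$, $P_n^i=0$ for $i\notin I_n$, and $\sum_{i\in I_n}P_n^i=\mathrm{id}$; and the same with $Q$ in place of $P$. 3. (Hodge decomposition.) Let $H_{n,i}$ be the $n$-th homology of the subcomplex $(P_m^iC_m(A,M))_{m\ge0}$ of $C_*(A,M)$, and let $H^{n,i}$ be the $n$-th cohomology of the subcomplex $(Q_m^iC^m(A,M))_{m\ge0}$ of $C^*(A,M)$. Then for every $n\ge0$ the inclusions induce isomorphisms of seminormed spaces (linear homeomorphisms for the quotient seminorms) $$\bigoplus_{i\in I_n}H_{n,i}\;\cong\;H_n(A,M),\qquad \bigoplus_{i\in I_n}H^{n,i}\;\cong\;H^n(A,M),$$ where $H_n(A,M)$ and $H^n(A,M)$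 are the continuous Hochschild homology and cohomology of $A$ with coefficients in $M$. -/

import Mathlib

open scoped TensorProduct

set_option linter.unusedSectionVars false

noncomputable section

/-! ### The projective tensor product of two Banach spaces -/

/-- The algebraic tensor product of two normed spaces, to be equipped with the projective
seminorm. -/
def ProjPre (E F : Type*) [NormedAddCommGroup E] [NormedSpace ℂ E]
    [NormedAddCommGroup F] [NormedSpace ℂ F] : Type _ := E ⊗[ℂ] F

namespace ProjPre

variable {E F : Type*} [NormedAddCommGroup E] [NormedSpace ℂ E]
  [NormedAddCommGroup F] [NormedSpace ℂ F]

instance : AddCommGroup (ProjPre E F) := inferInstanceAs (AddCommGroup (E ⊗[ℂ] F))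

instance : Module ℂ (ProjPre E F) := inferInstanceAs (Module ℂ (E ⊗[ℂ] F))

/-- The elementary tensor `x ⊗ y`. -/
def tmul (x : E) (y : F) : ProjPre E F := (x ⊗ₜ[ℂ] y : E ⊗[ℂ] F)

theorem add_tmul (x x' : E) (y : F) : tmul (x + x') y = tmul x y + tmul x' y :=
  TensorProduct.add_tmul x x' y

theorem tmul_add (x : E) (y y' : F) : tmul x (y + y') = tmul x y + tmul x y' :=
  TensorProduct.tmul_add x y y'

theorem smul_tmul (c : ℂ) (x : E) (y : F) : tmul (c • x) y = c • tmul x y :=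
  (TensorProduct.smul_tmul' c x y).symm

theorem tmul_smul (c : ℂ) (x : E) (y : F) : tmul x (c • y) = c • tmul x y :=
  TensorProduct.tmul_smul c x y

/-- The linear map on the algebraic tensor product induced by a bounded bilinear map. -/
def linLift {G : Type*} [NormedAddCommGroup G] [NormedSpace ℂ G] (B : E →L[ℂ] F →L[ℂ] G) :
    ProjPre E F →ₗ[ℂ] G :=
  (TensorProduct.lift (ContinuousLinearMap.toLinearMap₁₂ B) : E ⊗[ℂ] F →ₗ[ℂ] G)

theorem linLift_tmul {G : Type*} [NormedAddCommGroup G] [NormedSpace ℂ G]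
    (B : E →L[ℂ] F →L[ℂ] G) (x : E) (y : F) : linLift B (tmul x y) = B x y :=
  TensorProduct.lift.tmul x y

/-- The element `∑ⱼ xⱼ ⊗ yⱼ` represented by a finite list of pairs `(xⱼ, yⱼ)`. -/
def ofList (l : List (E × F)) : ProjPre E F := (l.map fun p => tmul p.1 p.2).sum

theorem ofList_nil : ofList ([] : List (E × F)) = 0 := rfl

theorem ofList_cons (p : E × F) (l : List (E × F)) :
    ofList (p :: l) = tmul p.1 p.2 + ofList l := by
  simp [ofList]

/-- The number `∑ⱼ ‖xⱼ‖ ‖yⱼ‖` attached to a finite list of pairs `(xⱼ, yⱼ)`. -/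
def cost (l : List (E × F)) : ℝ := (l.map fun p => ‖p.1‖ * ‖p.2‖).sum

/-- The projective seminorm: the infimum of `∑ⱼ ‖xⱼ‖ ‖yⱼ‖` over all representations
`t = ∑ⱼ xⱼ ⊗ yⱼ`. -/
def projNorm (t : ProjPre E F) : ℝ := ⨅ l : {l : List (E × F) // ofList l = t}, cost l.1

theorem ofList_append (l l' : List (E × F)) : ofList (l ++ l') = ofList l + ofList l' := by
  simp [ofList]

theorem cost_append (l l' : List (E × F)) : cost (l ++ l') = cost l + cost l' := by
  simp [cost]

theorem cost_nonneg (l : List (E × F)) : 0 ≤ cost l := by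
  refine List.sum_nonneg fun a ha => ?_
  obtain ⟨p, -, rfl⟩ := List.mem_map.1 ha
  positivity

theorem ofList_smul (c : ℂ) (l : List (E × F)) :
    ofList (l.map fun p => (c • p.1, p.2)) = c • ofList l := by
  induction l with
  | nil => simp [ofList_nil]
  | cons p l ih => rw [List.map_cons, ofList_cons, ofList_cons, ih, smul_add, smul_tmul]

theorem cost_smul (c : ℂ) (l : List (E × F)) :
    cost (l.map fun p => (c • p.1, p.2)) = ‖c‖ * cost l := by
  simp [cost, Function.comp_def, norm_smul, mul_assoc, List.sum_map_mul_left]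

theorem exists_ofList (t : ProjPre E F) : ∃ l : List (E × F), ofList l = t := by
  induction t using TensorProduct.induction_on with
  | zero => exact ⟨[], rfl⟩
  | tmul x y =>
    refine ⟨[(x, y)], ?_⟩
    rw [ofList_cons, ofList_nil, add_zero]
    rfl
  | add s t hs ht =>
    obtain ⟨l, rfl⟩ := hs
    obtain ⟨l', rfl⟩ := ht
    exact ⟨l ++ l', ofList_append l l'⟩

instance (t : ProjPre E F) : Nonempty {l : List (E × F) // ofList l = t} :=
  let ⟨l, hl⟩ := exists_ofList t
  ⟨⟨l, hl⟩⟩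

theorem bddBelow_cost (t : ProjPre E F) :
    BddBelow (Set.range fun l : {l : List (E × F) // ofList l = t} => cost l.1) :=
  ⟨0, by rintro _ ⟨l, rfl⟩; exact cost_nonneg _⟩

theorem projNorm_le (l : List (E × F)) : projNorm (ofList l) ≤ cost l :=
  ciInf_le (bddBelow_cost (ofList l)) ⟨l, rfl⟩

theorem projNorm_zero : projNorm (0 : ProjPre E F) = 0 :=
  le_antisymm (projNorm_le ([] : List (E × F))) (le_ciInf fun l => cost_nonneg l.1)

theorem projNorm_add_le (s t : ProjPre E F) : projNorm (s + t) ≤ projNorm s + projNorm t := by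
  refine le_ciInf_add_ciInf fun l l' => ?_
  have h := projNorm_le (l.1 ++ l'.1)
  rwa [ofList_append, cost_append, l.2, l'.2] at h

theorem projNorm_smul_le (c : ℂ) (t : ProjPre E F) : projNorm (c • t) ≤ ‖c‖ * projNorm t := by
  rw [projNorm, projNorm, Real.mul_iInf_of_nonneg (norm_nonneg _)]
  refine le_ciInf fun l => ?_
  have h := projNorm_le (l.1.map fun p => (c • p.1, p.2))
  rwa [ofList_smul, cost_smul, l.2] at h

/-- The projective seminorm as a bundled seminorm. -/
def projSeminorm : Seminorm ℂ (ProjPre E F) :=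
  .ofSMulLE projNorm projNorm_zero projNorm_add_le projNorm_smul_le

instance : SeminormedAddCommGroup (ProjPre E F) :=
  projSeminorm.toAddGroupSeminorm.toSeminormedAddCommGroup

instance : NormedSpace ℂ (ProjPre E F) := ⟨projNorm_smul_le⟩

theorem norm_eq_projNorm (t : ProjPre E F) : ‖t‖ = projNorm t := rfl

theorem norm_linLift_le {G : Type*} [NormedAddCommGroup G] [NormedSpace ℂ G]
    (B : E →L[ℂ] F →L[ℂ] G) (t : ProjPre E F) : ‖linLift B t‖ ≤ ‖B‖ * ‖t‖ := by
  rw [norm_eq_projNorm, projNorm, Real.mul_iInf_of_nonneg (norm_nonneg B)]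
  refine le_ciInf ?_
  rintro ⟨l, rfl⟩
  dsimp only
  induction l with
  | nil => simp [ofList_nil, cost]
  | cons p l ih =>
    have h : cost (p :: l) = ‖p.1‖ * ‖p.2‖ + cost l := by simp [cost]
    rw [ofList_cons, map_add, linLift_tmul, h, mul_add, ← mul_assoc]
    exact (norm_add_le _ _).trans (add_le_add (B.le_opNorm₂ _ _) ih)

/-- The bounded linear map on the algebraic tensor product induced by a bounded bilinear map. -/
def lift {G : Type*} [NormedAddCommGroup G] [NormedSpace ℂ G] (B : E →L[ℂ] F →L[ℂ] G) :
    ProjPre E F →L[ℂ] G :=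
  (linLift B).mkContinuous ‖B‖ (norm_linLift_le B)

end ProjPre

/-- The projective tensor product `E ⊗̂ F`. -/
abbrev ProjTensor (E F : Type*) [NormedAddCommGroup E] [NormedSpace ℂ E]
    [NormedAddCommGroup F] [NormedSpace ℂ F] : Type _ :=
  UniformSpace.Completion (ProjPre E F)

namespace ProjTensor

variable {E F E' F' G : Type*} [NormedAddCommGroup E] [NormedSpace ℂ E]
  [NormedAddCommGroup F] [NormedSpace ℂ F] [NormedAddCommGroup E'] [NormedSpace ℂ E']
  [NormedAddCommGroup F'] [NormedSpace ℂ F']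
  [NormedAddCommGroup G] [NormedSpace ℂ G]

/-- The canonical bounded bilinear map `(x, y) ↦ x ⊗ y`. -/
def tmulL : E →L[ℂ] F →L[ℂ] ProjTensor E F :=
  LinearMap.mkContinuous₂
    (LinearMap.mk₂ ℂ (fun x y => (ProjPre.tmul x y : ProjTensor E F))
      (fun x x' y => by rw [ProjPre.add_tmul, UniformSpace.Completion.coe_add])
      (fun c x y => by rw [ProjPre.smul_tmul, UniformSpace.Completion.coe_smul])
      (fun x y y' => by rw [ProjPre.tmul_add, UniformSpace.Completion.coe_add])
      (fun c x y => by rw [ProjPre.tmul_smul, UniformSpace.Completion.coe_smul]))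
    1 (fun x y => by
      rw [LinearMap.mk₂_apply, UniformSpace.Completion.norm_coe, one_mul, ProjPre.norm_eq_projNorm]
      have h := ProjPre.projNorm_le [(x, y)]
      rw [ProjPre.ofList_cons, ProjPre.ofList_nil, add_zero] at h
      simpa [ProjPre.cost] using h)

/-- The elementary tensor `x ⊗ y` in `E ⊗̂ F`. -/
def tmul (x : E) (y : F) : ProjTensor E F := tmulL x y

/-- Bounded linear maps out of `E ⊗̂ F` are determined by their values on elementary tensors. -/
theorem ext_tmul {f g : ProjTensor E F →L[ℂ] G} (h : ∀ x y, f (tmul x y) = g (tmul x y)) :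
    f = g := by
  ext t
  induction t using UniformSpace.Completion.induction_on with
  | hp => exact isClosed_eq f.continuous g.continuous
  | ih t =>
    obtain ⟨l, rfl⟩ := ProjPre.exists_ofList t
    induction l with
    | nil => rw [ProjPre.ofList_nil, UniformSpace.Completion.coe_zero, map_zero, map_zero]
    | cons p l ih =>
      rw [ProjPre.ofList_cons, UniformSpace.Completion.coe_add, map_add, map_add, ih]
      exact congrArg (· + _) (h p.1 p.2)

variable [CompleteSpace G]

/-- The bounded linear map on `E ⊗̂ F` induced by a bounded bilinear map. -/
def lift (B : E →L[ℂ] F →L[ℂ] G) : ProjTensor E F →L[ℂ] G :=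
  (ProjPre.lift B).extend UniformSpace.Completion.toComplL

theorem lift_tmul (B : E →L[ℂ] F →L[ℂ] G) (x : E) (y : F) : lift B (tmul x y) = B x y :=
  (ContinuousLinearMap.extend_eq (ProjPre.lift B)
    (e := UniformSpace.Completion.toComplL (𝕜 := ℂ))
    UniformSpace.Completion.denseRange_coe
    (UniformSpace.Completion.isUniformInducing_coe _) _).trans
    (ProjPre.linLift_tmul B x y)

/-- The bounded linear map `f ⊗̂ g`, determined by `x ⊗ y ↦ f x ⊗ g y`. -/
def map (f : E →L[ℂ] E') (g : F →L[ℂ] F') : ProjTensor E F →L[ℂ] ProjTensor E' F' :=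
  lift (tmulL.bilinearComp f g)

theorem map_tmul (f : E →L[ℂ] E') (g : F →L[ℂ] F') (x : E) (y : F) :
    map f g (tmul x y) = tmul (f x) (g y) :=
  lift_tmul _ _ _

end ProjTensor

/-! ### The projective tensor power of a Banach space -/

/-- The `n`-fold projective tensor power `A ⊗̂ ⋯ ⊗̂ A` (the scalar field for `n = 0`): the
completion of the algebraic tensor power for the projective seminorm. -/
abbrev TensorPow (A : Type*) [NormedAddCommGroup A] [NormedSpace ℂ A] (n : ℕ) : Type _ :=
  UniformSpace.Completion (⨂[ℂ] _ : Fin n, A)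

namespace TensorPow

variable {A G : Type*} [NormedAddCommGroup A] [NormedSpace ℂ A]
  [NormedAddCommGroup G] [NormedSpace ℂ G] {n : ℕ}

/-- The canonical bounded multilinear map `(a₁, …, aₙ) ↦ a₁ ⊗ ⋯ ⊗ aₙ`. -/
def tprod (A : Type*) [NormedAddCommGroup A] [NormedSpace ℂ A] (n : ℕ) :
    ContinuousMultilinearMap ℂ (fun _ : Fin n => A) (TensorPow A n) :=
  (UniformSpace.Completion.toComplL (𝕜 := ℂ)).compContinuousMultilinearMap
    (PiTensorProduct.tprodL ℂ)

/-- Bounded linear maps out of `A ⊗̂ ⋯ ⊗̂ A` are determined by their values on elementary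
tensors. -/
theorem ext_tprod {f g : TensorPow A n →L[ℂ] G} (h : ∀ a, f (tprod A n a) = g (tprod A n a)) :
    f = g := by
  have key : f.comp (UniformSpace.Completion.toComplL (𝕜 := ℂ))
      = g.comp (UniformSpace.Completion.toComplL (𝕜 := ℂ)) := by
    apply ContinuousLinearMap.coe_injective
    apply PiTensorProduct.ext
    ext a
    have := h a
    simpa [tprod] using this
  ext t
  induction t using UniformSpace.Completion.induction_on with
  | hp => exact isClosed_eq f.continuous g.continuous
  | ih t => exact DFunLike.congr_fun key t

variable [CompleteSpace G]

/-- The bounded linear map on `A ⊗̂ ⋯ ⊗̂ A` induced by a bounded multilinear map. -/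
def lift (f : ContinuousMultilinearMap ℂ (fun _ : Fin n => A) G) : TensorPow A n →L[ℂ] G :=
  (PiTensorProduct.liftIsometry ℂ (fun _ : Fin n => A) G f).extend
    UniformSpace.Completion.toComplL

theorem lift_tprod (f : ContinuousMultilinearMap ℂ (fun _ : Fin n => A) G) (a : Fin n → A) :
    lift f (tprod A n a) = f a := by
  refine (ContinuousLinearMap.extend_eq (PiTensorProduct.liftIsometry ℂ (fun _ : Fin n => A) G f)
    (e := UniformSpace.Completion.toComplL (𝕜 := ℂ))
    UniformSpace.Completion.denseRange_coe
    (UniformSpace.Completion.isUniformInducing_coe _) _).trans ?_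
  simp

theorem norm_lift_le (f : ContinuousMultilinearMap ℂ (fun _ : Fin n => A) G)
    (t : TensorPow A n) : ‖lift f t‖ ≤ ‖f‖ * ‖t‖ := by
  induction t using UniformSpace.Completion.induction_on with
  | hp => exact isClosed_le (by fun_prop) (by fun_prop)
  | ih t =>
    have h : lift f (t : TensorPow A n) = PiTensorProduct.liftIsometry ℂ (fun _ : Fin n => A) G f t :=
      ContinuousLinearMap.extend_eq (PiTensorProduct.liftIsometry ℂ (fun _ : Fin n => A) G f)
        (e := UniformSpace.Completion.toComplL (𝕜 := ℂ))
        UniformSpace.Completion.denseRange_coe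
        (UniformSpace.Completion.isUniformInducing_coe _) t
    rw [h, UniformSpace.Completion.norm_coe, PiTensorProduct.liftIsometry_apply_apply]
    exact PiTensorProduct.norm_eval_le_projectiveSeminorm f t

theorem opNorm_lift_le (f : ContinuousMultilinearMap ℂ (fun _ : Fin n => A) G) :
    ‖lift f‖ ≤ ‖f‖ :=
  ContinuousLinearMap.opNorm_le_bound (lift f) (norm_nonneg f) (norm_lift_le f)

/-- The map `lift`, as a linear map in the multilinear map. -/
def liftLin : ContinuousMultilinearMap ℂ (fun _ : Fin n => A) G →ₗ[ℂ] TensorPow A n →L[ℂ] G where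
  toFun := lift
  map_add' f g := ext_tprod fun a => by
    rw [_root_.add_apply, lift_tprod, lift_tprod, lift_tprod]; rfl
  map_smul' c f := ext_tprod fun a => by
    rw [RingHom.id_apply, _root_.smul_apply, lift_tprod, lift_tprod]; rfl

/-- The map `lift`, as a bounded linear map in the multilinear map. -/
def liftL : ContinuousMultilinearMap ℂ (fun _ : Fin n => A) G →L[ℂ] TensorPow A n →L[ℂ] G :=
  LinearMap.mkContinuous (E := ContinuousMultilinearMap ℂ (fun _ : Fin n => A) G)
    (F := TensorPow A n →L[ℂ] G) liftLin 1 fun f => (opNorm_lift_le f).trans_eq (one_mul ‖f‖).symm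

theorem liftL_tprod (f : ContinuousMultilinearMap ℂ (fun _ : Fin n => A) G) (a : Fin n → A) :
    liftL f (tprod A n a) = f a :=
  lift_tprod f a

end TensorPow

/-- Composition with a fixed bounded multilinear map `t`, as a bounded linear map
`g ↦ g ∘ t`. -/
def compMultilinearL {A F G : Type*} [NormedAddCommGroup A] [NormedSpace ℂ A]
    [NormedAddCommGroup F] [NormedSpace ℂ F] [NormedAddCommGroup G] [NormedSpace ℂ G] {n : ℕ}
    (t : ContinuousMultilinearMap ℂ (fun _ : Fin n => A) F) :
    (F →L[ℂ] G) →L[ℂ] ContinuousMultilinearMap ℂ (fun _ : Fin n => A) G :=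
  LinearMap.mkContinuous
    { toFun := fun g => g.compContinuousMultilinearMap t
      map_add' := fun _ _ => rfl
      map_smul' := fun _ _ => rfl }
    ‖t‖ (fun g => by
      rw [mul_comm]
      exact g.norm_compContinuousMultilinearMap_le t)

/-! ### The Eulerian (Barr-Gerstenhaber-Schack) idempotents -/

/-- The total shuffle element `∑_{0 < p < n} ∑_σ sgn(σ) σ` of `ℚ Sₙ`, where `σ` runs over the
`(p, n - p)`-shuffles: the permutations that are increasing on the first `p` letters and on the
last `n - p` letters. -/
def shuffleElement (n : ℕ) : MonoidAlgebra ℚ (Equiv.Perm (Fin n)) :=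
  ∑ p ∈ Finset.Ioo 0 n,
    ∑ σ : Equiv.Perm (Fin n) with
        (∀ i j : Fin n, i < j → (j : ℕ) < p → σ i < σ j) ∧
        (∀ i j : Fin n, i < j → p ≤ (i : ℕ) → σ i < σ j),
      MonoidAlgebra.single σ (((Equiv.Perm.sign σ : ℤˣ) : ℤ) : ℚ)

/-- The types occurring in degree `n`: these are `1, …, n` if `n ≥ 1`, and `0` if `n = 0`. -/
def bgsIndex (n : ℕ) : Finset ℕ := if n = 0 then {0} else Finset.Icc 1 n

/-- The Eulerian idempotent `eₙ(i) ∈ ℚ Sₙ` of Barr, Gerstenhaber and Schack: the polynomial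
`∏_{k ≠ i} (s - λₖ) / (λᵢ - λₖ)`, with `1 ≤ k ≤ n` and `λₖ = 2 ^ k - 2`, in the total shuffle
element `s` of `ℚ Sₙ`, if `1 ≤ i ≤ n`, and `0` for any other `i`. In degree `0` the only nonzero
idempotent is `e₀(0) = 1`. -/
def bgs (n i : ℕ) : MonoidAlgebra ℚ (Equiv.Perm (Fin n)) :=
  if i ∈ bgsIndex n then
    Polynomial.aeval (shuffleElement n)
      (Lagrange.basis (bgsIndex n) (fun k => (2 : ℚ) ^ k - 2) i)
  else 0

/-- The permutation `σ` acting on `A ⊗̂ ⋯ ⊗̂ A` from the left: it moves the `k`-th factor to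
position `σ k`. -/
def permAct {A : Type*} [NormedAddCommGroup A] [NormedSpace ℂ A] {n : ℕ}
    (σ : Equiv.Perm (Fin n)) : TensorPow A n →L[ℂ] TensorPow A n :=
  TensorPow.lift ((TensorPow.tprod A n).domDomCongr σ⁻¹)

theorem permAct_tprod {A : Type*} [NormedAddCommGroup A] [NormedSpace ℂ A] {n : ℕ}
    (σ : Equiv.Perm (Fin n)) (a : Fin n → A) :
    permAct σ (TensorPow.tprod A n a) = TensorPow.tprod A n (fun k => a (σ⁻¹ k)) :=
  TensorPow.lift_tprod _ _

/-- The action of an element of `ℚ Sₙ` on `A ⊗̂ ⋯ ⊗̂ A`. -/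
def groupAlgAct {A : Type*} [NormedAddCommGroup A] [NormedSpace ℂ A] {n : ℕ}
    (x : MonoidAlgebra ℚ (Equiv.Perm (Fin n))) : TensorPow A n →L[ℂ] TensorPow A n :=
  ∑ σ : Equiv.Perm (Fin n), ((x.coeff σ : ℚ) : ℂ) • permAct σ

/-- Precomposition of a bounded multilinear map with the action of an element of `ℚ Sₙ`. -/
def precomp {A M : Type*} [NormedAddCommGroup A] [NormedSpace ℂ A]
    [NormedAddCommGroup M] [NormedSpace ℂ M] {n : ℕ}
    (x : MonoidAlgebra ℚ (Equiv.Perm (Fin n))) :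
    ContinuousMultilinearMap ℂ (fun _ : Fin n => A) M →L[ℂ]
      ContinuousMultilinearMap ℂ (fun _ : Fin n => A) M :=
  ∑ σ : Equiv.Perm (Fin n), ((x.coeff σ : ℚ) : ℂ) •
    ((ContinuousMultilinearMap.domDomCongrₗᵢ ℂ A M σ⁻¹).toContinuousLinearEquiv :
      ContinuousMultilinearMap ℂ (fun _ : Fin n => A) M →L[ℂ]
        ContinuousMultilinearMap ℂ (fun _ : Fin n => A) M)

/-- `precomp x ψ` is the composite of `ψ`, viewed as a linear map on the tensor power, with the
action of `x`. -/
theorem precomp_apply {A M : Type*} [NormedAddCommGroup A] [NormedSpace ℂ A]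
    [NormedAddCommGroup M] [NormedSpace ℂ M] [CompleteSpace M] {n : ℕ}
    (x : MonoidAlgebra ℚ (Equiv.Perm (Fin n)))
    (ψ : ContinuousMultilinearMap ℂ (fun _ : Fin n => A) M) (a : Fin n → A) :
    precomp x ψ a = TensorPow.lift ψ (groupAlgAct x (TensorPow.tprod A n a)) := by
  simp [precomp, groupAlgAct, permAct_tprod, TensorPow.lift_tprod]
  rfl

/-! ### Banach bimodules and the Hochschild complexes -/

/-- A Banach bimodule structure on the Banach space `M` over the (not necessarily unital) Banach
algebra `A`: bounded bilinear left and right actions that are associative and commute. -/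
structure BanachBimodule (A M : Type*) [NonUnitalNormedRing A] [NormedSpace ℂ A]
    [NormedAddCommGroup M] [NormedSpace ℂ M] where
  /-- The left action `(a, m) ↦ a m`. -/
  left : A →L[ℂ] M →L[ℂ] M
  /-- The right action `(a, m) ↦ m a`. -/
  right : A →L[ℂ] M →L[ℂ] M
  left_mul : ∀ a b m, left (a * b) m = left a (left b m)
  right_mul : ∀ a b m, right (a * b) m = right b (right a m)
  right_left : ∀ a b m, right b (left a m) = left a (right b m)

/-- A bimodule is symmetric if `a m = m a` for all `a` and `m`. -/
def BanachBimodule.IsSymmetric {A M : Type*} [NonUnitalNormedRing A] [NormedSpace ℂ A]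
    [NormedAddCommGroup M] [NormedSpace ℂ M] (X : BanachBimodule A M) : Prop :=
  ∀ a m, X.left a m = X.right a m

section Merge

variable {A : Type*} [NonUnitalNormedRing A] {n : ℕ}

/-- The tuple `(a₁, …, aⱼ aⱼ₊₁, …, aₙ₊₁)` (with `j` counted from `0` in the code). -/
def merge (j : Fin n) (a : Fin (n + 1) → A) : Fin n → A :=
  Fin.contractNth j.castSucc (· * ·) a

theorem merge_apply (j : Fin n) (a : Fin (n + 1) → A) (k : Fin n) :
    merge j a k = if k = j then a j.castSucc * a j.succ else a (j.succ.succAbove k) := by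
  rcases lt_trichotomy k j with h | h | h
  · rw [if_neg h.ne, merge, Fin.contractNth_apply_of_lt _ _ _ _ (by simpa using h),
      Fin.succAbove_of_castSucc_lt _ _ (by rw [Fin.lt_def]; simp; omega)]
  · subst h
    rw [if_pos rfl, merge, Fin.contractNth_apply_of_eq _ _ _ _ (by simp)]
  · rw [if_neg h.ne', merge, Fin.contractNth_apply_of_gt _ _ _ _ (by simpa using h),
      Fin.succAbove_of_le_castSucc _ _ (by rw [Fin.le_def]; simp; omega)]

theorem prod_norm_merge_le (j : Fin n) (a : Fin (n + 1) → A) :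
    ∏ k, ‖merge j a k‖ ≤ ∏ k, ‖a k‖ := by
  rw [Fin.prod_univ_succAbove (fun k => ‖a k‖) j.succ]
  have h : ∏ k, ‖merge j a k‖
      ≤ ∏ k, ((if k = j then ‖a j.succ‖ else 1) * ‖a (j.succ.succAbove k)‖) := by
    refine Finset.prod_le_prod (fun _ _ => norm_nonneg _) fun k _ => ?_
    rw [merge_apply]
    split_ifs with hk
    · subst hk
      have : k.succ.succAbove k = k.castSucc :=
        Fin.succAbove_of_castSucc_lt _ _ (by rw [Fin.lt_def]; simp)
      rw [this, mul_comm]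
      exact norm_mul_le _ _
    · simp
  refine h.trans (le_of_eq ?_)
  rw [Finset.prod_mul_distrib]
  simp

variable [NormedSpace ℂ A]

theorem merge_update_of_eq (j : Fin n) (a : Fin (n + 1) → A) (x : A) :
    merge j (Function.update a j.succ x)
      = Function.update (merge j a) j (a j.castSucc * x) := by
  funext k
  by_cases hk : k = j
  · subst hk
    simp [merge_apply, Fin.castSucc_lt_succ.ne]
  · simp [merge_apply, hk, Fin.succAbove_ne]

theorem merge_update_of_ne (j : Fin n) (a : Fin (n + 1) → A) (k : Fin n) (x : A) :
    merge j (Function.update a (j.succ.succAbove k) x)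
      = Function.update (merge j a) k (if k = j then x * a j.succ else x) := by
  have hj : j.succ.succAbove j = j.castSucc :=
    Fin.succAbove_of_castSucc_lt _ _ (by rw [Fin.lt_def]; simp)
  funext l
  by_cases hl : l = k
  · subst hl
    by_cases hlj : l = j
    · subst hlj
      simp [merge_apply, hj, Fin.castSucc_lt_succ.ne']
    · simp [merge_apply, hlj]
  · have hne : j.succ.succAbove l ≠ j.succ.succAbove k :=
      fun h => hl (Fin.succAbove_right_injective h)
    by_cases hlj : l = j
    · subst hlj
      have h1 : l.castSucc ≠ l.succ.succAbove k := by rw [← hj]; exact hne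
      have h2 : l.succ ≠ l.succ.succAbove k := (Fin.succAbove_ne _ _).symm
      simp [merge_apply, hl, h1, h2]
    · simp [merge_apply, hl, hlj, hne]

variable [IsScalarTower ℂ A A] [SMulCommClass ℂ A A]
  {G : Type*} [NormedAddCommGroup G] [NormedSpace ℂ G]

/-- The bounded multilinear map `(a₁, …, aₙ₊₁) ↦ g (a₁, …, aⱼ aⱼ₊₁, …, aₙ₊₁)`. -/
def mergeComp (j : Fin n) (g : ContinuousMultilinearMap ℂ (fun _ : Fin n => A) G) :
    ContinuousMultilinearMap ℂ (fun _ : Fin (n + 1) => A) G :=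
  MultilinearMap.mkContinuous
    (MultilinearMap.mk' (fun a => g (merge j a))
      (fun a i x y => by
        rcases Fin.eq_self_or_eq_succAbove j.succ i with h | ⟨k, h⟩
        · subst h
          simp only [merge_update_of_eq, mul_add, ContinuousMultilinearMap.map_update_add]
        · subst h
          simp only [merge_update_of_ne]
          split_ifs <;> simp only [add_mul, ContinuousMultilinearMap.map_update_add])
      (fun a i c x => by
        rcases Fin.eq_self_or_eq_succAbove j.succ i with h | ⟨k, h⟩
        · subst h
          simp only [merge_update_of_eq, mul_smul_comm, ContinuousMultilinearMap.map_update_smul]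
        · subst h
          simp only [merge_update_of_ne]
          split_ifs <;>
            simp only [smul_mul_assoc, ContinuousMultilinearMap.map_update_smul]))
    ‖g‖ (fun a => (g.le_opNorm _).trans
      (mul_le_mul_of_nonneg_left (prod_norm_merge_le j a) (norm_nonneg g)))

theorem mergeComp_apply (j : Fin n) (g : ContinuousMultilinearMap ℂ (fun _ : Fin n => A) G)
    (a : Fin (n + 1) → A) : mergeComp j g a = g (merge j a) :=
  rfl

theorem norm_mergeComp_le (j : Fin n) (g : ContinuousMultilinearMap ℂ (fun _ : Fin n => A) G) :
    ‖mergeComp j g‖ ≤ ‖g‖ :=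
  MultilinearMap.mkContinuous_norm_le _ (norm_nonneg g) _

/-- The map `mergeComp`, as a bounded linear map in `g`. -/
def mergeCompL (j : Fin n) :
    ContinuousMultilinearMap ℂ (fun _ : Fin n => A) G →L[ℂ]
      ContinuousMultilinearMap ℂ (fun _ : Fin (n + 1) => A) G :=
  LinearMap.mkContinuous
    { toFun := mergeComp j
      map_add' := fun f g => by ext a; simp [mergeComp_apply]
      map_smul' := fun c f => by ext a; simp [mergeComp_apply] }
    1 (fun g => by
      rw [one_mul]
      exact norm_mergeComp_le j g)

end Merge

namespace Hochschild

/-- The space `Cₙ(A, M) = M ⊗̂ A ⊗̂ ⋯ ⊗̂ A` of Hochschild `n`-chains. -/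
abbrev Chain (A M : Type*) [NonUnitalNormedRing A] [NormedSpace ℂ A]
    [NormedAddCommGroup M] [NormedSpace ℂ M] (n : ℕ) : Type _ :=
  ProjTensor M (TensorPow A n)

/-- The space `Cⁿ(A, M)` of Hochschild `n`-cochains: the bounded `n`-linear maps from `A` to
`M`. -/
abbrev Cochain (A M : Type*) [NonUnitalNormedRing A] [NormedSpace ℂ A]
    [NormedAddCommGroup M] [NormedSpace ℂ M] (n : ℕ) : Type _ :=
  ContinuousMultilinearMap ℂ (fun _ : Fin n => A) M

variable {A M : Type*} [NonUnitalNormedRing A] [NormedSpace ℂ A]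
  [NormedAddCommGroup M] [NormedSpace ℂ M]

/-- The elementary chain `m ⊗ a₁ ⊗ ⋯ ⊗ aₙ`. -/
def elem {n : ℕ} (m : M) (a : Fin n → A) : Chain A M n :=
  ProjTensor.tmul m (TensorPow.tprod A n a)

/-- The face map `m ⊗ a₁ ⊗ ⋯ ⊗ aₙ₊₁ ↦ m a₁ ⊗ a₂ ⊗ ⋯ ⊗ aₙ₊₁`. -/
def faceFirst (X : BanachBimodule A M) (n : ℕ) : Chain A M (n + 1) →L[ℂ] Chain A M n :=
  let T : M →L[ℂ] ContinuousMultilinearMap ℂ (fun _ : Fin n => A) (Chain A M n) :=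
    compMultilinearL (TensorPow.tprod A n) ∘L ProjTensor.tmulL
  let K : M →L[ℂ] A →L[ℂ] ContinuousMultilinearMap ℂ (fun _ : Fin n => A) (Chain A M n) :=
    (ContinuousLinearMap.compL ℂ A M _ T) ∘L X.right.flip
  ProjTensor.lift (TensorPow.liftL ∘L
    ((continuousMultilinearCurryLeftEquiv ℂ (fun _ : Fin (n + 1) => A)
      (Chain A M n)).symm.toContinuousLinearEquiv.toContinuousLinearMap ∘L K))

theorem faceFirst_elem (X : BanachBimodule A M) (n : ℕ) (m : M) (a : Fin (n + 1) → A) :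
    faceFirst X n (elem m a) = elem (X.right (a 0) m) (Fin.tail a) := by
  unfold faceFirst elem
  rw [ProjTensor.lift_tmul]
  exact TensorPow.liftL_tprod _ _

/-- The face map `m ⊗ a₁ ⊗ ⋯ ⊗ aₙ₊₁ ↦ m ⊗ a₁ ⊗ ⋯ ⊗ aⱼ aⱼ₊₁ ⊗ ⋯ ⊗ aₙ₊₁` (with `j` counted from
`0` in the code). -/
def faceMiddle (A M : Type*) [NonUnitalNormedRing A] [NormedSpace ℂ A]
    [IsScalarTower ℂ A A] [SMulCommClass ℂ A A]
    [NormedAddCommGroup M] [NormedSpace ℂ M] {n : ℕ} (j : Fin n) :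
    Chain A M (n + 1) →L[ℂ] Chain A M n :=
  ProjTensor.map (ContinuousLinearMap.id ℂ M) (TensorPow.lift (mergeComp j (TensorPow.tprod A n)))

theorem faceMiddle_elem [IsScalarTower ℂ A A] [SMulCommClass ℂ A A] {n : ℕ} (j : Fin n) (m : M)
    (a : Fin (n + 1) → A) : faceMiddle A M j (elem m a) = elem m (merge j a) := by
  unfold faceMiddle elem
  rw [ProjTensor.map_tmul, TensorPow.lift_tprod]
  rfl

/-- The face map `m ⊗ a₁ ⊗ ⋯ ⊗ aₙ₊₁ ↦ aₙ₊₁ m ⊗ a₁ ⊗ ⋯ ⊗ aₙ`. -/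
def faceLast (X : BanachBimodule A M) (n : ℕ) : Chain A M (n + 1) →L[ℂ] Chain A M n :=
  let K : M →L[ℂ] TensorPow A n →L[ℂ] A →L[ℂ] Chain A M n :=
    (ContinuousLinearMap.flipₗᵢ ℂ A (TensorPow A n)
        (Chain A M n)).toContinuousLinearEquiv.toContinuousLinearMap ∘L
      (ContinuousLinearMap.compL ℂ A M _ ProjTensor.tmulL) ∘L X.left.flip
  let T : M →L[ℂ] ContinuousMultilinearMap ℂ (fun _ : Fin n => A) (A →L[ℂ] Chain A M n) :=
    compMultilinearL (TensorPow.tprod A n) ∘L K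
  ProjTensor.lift (TensorPow.liftL ∘L
    ((continuousMultilinearCurryRightEquiv ℂ (fun _ : Fin (n + 1) => A)
      (Chain A M n)).symm.toContinuousLinearEquiv.toContinuousLinearMap ∘L T))

theorem faceLast_elem (X : BanachBimodule A M) (n : ℕ) (m : M) (a : Fin (n + 1) → A) :
    faceLast X n (elem m a) = elem (X.left (a (Fin.last n)) m) (Fin.init a) := by
  unfold faceLast elem
  rw [ProjTensor.lift_tmul]
  exact TensorPow.liftL_tprod _ _

/-- The Hochschild boundary operator `dₙ : Cₙ₊₁(A, M) → Cₙ(A, M)`, the alternating sum of the face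
maps. -/
def boundary [IsScalarTower ℂ A A] [SMulCommClass ℂ A A] (X : BanachBimodule A M) (n : ℕ) :
    Chain A M (n + 1) →L[ℂ] Chain A M n :=
  faceFirst X n + ∑ j : Fin n, (-1 : ℂ) ^ ((j : ℕ) + 1) • faceMiddle A M j
    + (-1 : ℂ) ^ (n + 1) • faceLast X n

/-- The bounded linear map sending `ψ` to `(a₁, …, aₙ₊₁) ↦ a₁ ψ(a₂, …, aₙ₊₁)`. -/
def cofaceFirst (X : BanachBimodule A M) (n : ℕ) : Cochain A M n →L[ℂ] Cochain A M (n + 1) :=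
  (continuousMultilinearCurryLeftEquiv ℂ (fun _ : Fin (n + 1) => A)
      M).symm.toContinuousLinearEquiv.toContinuousLinearMap ∘L
    (((ContinuousLinearMap.compContinuousMultilinearMapL ℂ (fun _ : Fin n => A) M M) ∘L
      X.left).flip)

theorem cofaceFirst_apply (X : BanachBimodule A M) (n : ℕ) (ψ : Cochain A M n)
    (a : Fin (n + 1) → A) : cofaceFirst X n ψ a = X.left (a 0) (ψ (Fin.tail a)) :=
  rfl

/-- The bounded linear map sending `ψ` to `(a₁, …, aₙ₊₁) ↦ ψ(a₁, …, aₙ) aₙ₊₁`. -/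
def cofaceLast (X : BanachBimodule A M) (n : ℕ) : Cochain A M n →L[ℂ] Cochain A M (n + 1) :=
  (continuousMultilinearCurryRightEquiv ℂ (fun _ : Fin (n + 1) => A)
      M).symm.toContinuousLinearEquiv.toContinuousLinearMap ∘L
    (ContinuousLinearMap.compContinuousMultilinearMapL ℂ (fun _ : Fin n => A) M (A →L[ℂ] M)
      X.right.flip)

theorem cofaceLast_apply (X : BanachBimodule A M) (n : ℕ) (ψ : Cochain A M n)
    (a : Fin (n + 1) → A) :
    cofaceLast X n ψ a = X.right (a (Fin.last n)) (ψ (Fin.init a)) :=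
  rfl

/-- The Hochschild coboundary operator `δⁿ : Cⁿ(A, M) → Cⁿ⁺¹(A, M)`. -/
def coboundary [IsScalarTower ℂ A A] [SMulCommClass ℂ A A] (X : BanachBimodule A M) (n : ℕ) :
    Cochain A M n →L[ℂ] Cochain A M (n + 1) :=
  cofaceFirst X n + ∑ j : Fin n, (-1 : ℂ) ^ ((j : ℕ) + 1) • mergeCompL j
    + (-1 : ℂ) ^ (n + 1) • cofaceLast X n

/-- The operator `id ⊗̂ eₙ(i)` on `Cₙ(A, M)`. -/
def chainBGS (A M : Type*) [NonUnitalNormedRing A] [NormedSpace ℂ A]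
    [NormedAddCommGroup M] [NormedSpace ℂ M] (n i : ℕ) : Chain A M n →L[ℂ] Chain A M n :=
  ProjTensor.map (ContinuousLinearMap.id ℂ M) (groupAlgAct (bgs n i))

/-- Precomposition with `eₙ(i)` on `Cⁿ(A, M)`. -/
def cochainBGS (A M : Type*) [NonUnitalNormedRing A] [NormedSpace ℂ A]
    [NormedAddCommGroup M] [NormedSpace ℂ M] (n i : ℕ) : Cochain A M n →L[ℂ] Cochain A M n :=
  precomp (bgs n i)

end Hochschild

/-! ### Homology and cohomology of complexes of normed spaces and of their subcomplexes

All homology spaces carry the quotient seminorm. -/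

section Homology

variable {C : ℕ → Type*} [∀ n, NormedAddCommGroup (C n)] [∀ n, NormedSpace ℂ (C n)]

/-- The `n`-cycles of the chain complex `(C, d)`. -/
def cycles (d : ∀ n, C (n + 1) →L[ℂ] C n) : ∀ n, Submodule ℂ (C n)
  | 0 => ⊤
  | n + 1 => (d n).ker

/-- The `n`-boundaries of the chain complex `(C, d)`. -/
def boundaries (d : ∀ n, C (n + 1) →L[ℂ] C n) (n : ℕ) : Submodule ℂ (C n) := (d n).range

/-- The `n`-th homology of the chain complex `(C, d)`. -/
abbrev HomologyOf (d : ∀ n, C (n + 1) →L[ℂ] C n) (n : ℕ) : Type _ :=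
  cycles d n ⧸ (boundaries d n).submoduleOf (cycles d n)

/-- The `n`-cycles of the subcomplex `S` of `(C, d)`. -/
def subCycles (d : ∀ n, C (n + 1) →L[ℂ] C n) (S : ∀ n, Submodule ℂ (C n)) (n : ℕ) :
    Submodule ℂ (C n) := cycles d n ⊓ S n

/-- The `n`-boundaries of the subcomplex `S` of `(C, d)`. -/
def subBoundaries (d : ∀ n, C (n + 1) →L[ℂ] C n) (S : ∀ n, Submodule ℂ (C n)) (n : ℕ) :
    Submodule ℂ (C n) := (S (n + 1)).map (d n : C (n + 1) →ₗ[ℂ] C n)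

/-- The `n`-th homology of the subcomplex `S` of `(C, d)`. -/
abbrev SubHomologyOf (d : ∀ n, C (n + 1) →L[ℂ] C n) (S : ∀ n, Submodule ℂ (C n)) (n : ℕ) :
    Type _ :=
  subCycles d S n ⧸ (subBoundaries d S n).submoduleOf (subCycles d S n)

/-- The `n`-cocycles of the cochain complex `(C, δ)`. -/
def cocycles (δ : ∀ n, C n →L[ℂ] C (n + 1)) (n : ℕ) : Submodule ℂ (C n) := (δ n).ker

/-- The `n`-coboundaries of the cochain complex `(C, δ)`. -/
def coboundaries (δ : ∀ n, C n →L[ℂ] C (n + 1)) : ∀ n, Submodule ℂ (C n)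
  | 0 => ⊥
  | n + 1 => (δ n).range

/-- The `n`-th cohomology of the cochain complex `(C, δ)`. -/
abbrev CohomologyOf (δ : ∀ n, C n →L[ℂ] C (n + 1)) (n : ℕ) : Type _ :=
  cocycles δ n ⧸ (coboundaries δ n).submoduleOf (cocycles δ n)

/-- The `n`-cocycles of the subcomplex `S` of `(C, δ)`. -/
def subCocycles (δ : ∀ n, C n →L[ℂ] C (n + 1)) (S : ∀ n, Submodule ℂ (C n)) (n : ℕ) :
    Submodule ℂ (C n) := cocycles δ n ⊓ S n

/-- The `n`-coboundaries of the subcomplex `S` of `(C, δ)`. -/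
def subCoboundaries (δ : ∀ n, C n →L[ℂ] C (n + 1)) (S : ∀ n, Submodule ℂ (C n)) :
    ∀ n, Submodule ℂ (C n)
  | 0 => ⊥
  | n + 1 => (S n).map (δ n : C n →ₗ[ℂ] C (n + 1))

/-- The `n`-th cohomology of the subcomplex `S` of `(C, δ)`. -/
abbrev SubCohomologyOf (δ : ∀ n, C n →L[ℂ] C (n + 1)) (S : ∀ n, Submodule ℂ (C n)) (n : ℕ) :
    Type _ :=
  subCocycles δ S n ⧸ (subCoboundaries δ S n).submoduleOf (subCocycles δ S n)

end Homology

namespace Hochschild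

/-- The summand `C_{i,*}(A, M)` of type `i` of the Hochschild chain complex; in degree `n` it is
the range of `id ⊗̂ eₙ(i)`. -/
def chainSummand (A M : Type*) [NonUnitalNormedRing A] [NormedSpace ℂ A]
    [NormedAddCommGroup M] [NormedSpace ℂ M] (i n : ℕ) : Submodule ℂ (Chain A M n) :=
  (chainBGS A M n i).range

/-- The summand `C^{i,*}(A, M)` of type `i` of the Hochschild cochain complex; in degree `n` it is
the range of precomposition with `eₙ(i)`. -/
def cochainSummand (A M : Type*) [NonUnitalNormedRing A] [NormedSpace ℂ A]
    [NormedAddCommGroup M] [NormedSpace ℂ M] (i n : ℕ) : Submodule ℂ (Cochain A M n) :=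
  (cochainBGS A M n i).range

end Hochschild

end

/-! ### Shuffles and the Hochschild boundary on words -/

/-! The theorem rests on two facts about the total shuffle element `s_n`: it commutes with the
Hochschild boundary, and it satisfies `∏_{1 ≤ k ≤ n} (s_n - λ_k) = 0` with `λ_k = 2 ^ k - 2`.

For the first fact, `s_n + 2` (for `n ≥ 1`) is the operator that cuts a word in all ways, trivial
cuts included, and shuffles the two pieces. The boundary is a graded derivation of the signed
shuffle product, because the products `ab` and `ba` of letters from different pieces occur with
opposite signs (`shuffleSum_wordBoundary`). In the sum over all cuts, the face that absorbs the last
letter of the left piece cancels the face that absorbs the same letter as first letter of the right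
piece at the neighbouring cut (`cutSum_laterFaces`). What remains is the boundary of the whole word,
cut and shuffled (`permSum_shuffleElement_tupleBoundary`).

The second fact is by induction on `n`, after Barr. If `f` kills `s_n`, then `f(s_{n+1})` is
annihilated by every boundary, in particular over a free commutative monoid, and this forces its
coefficients to be alternating. Each of the `2 ^ (n+1) - 2` signed permutations in `s_{n+1}` fixes
an alternating element, so `s_{n+1} - λ_{n+1}` kills `f(s_{n+1})` (`aeval_shuffleElement_prod`).

The nodes `λ_k` are distinct, so `p(s_n)` depends only on the values of `p` at `λ_1, …, λ_n`. The
`e_n(i)` are the Lagrange basis polynomials in `s_n`, hence complete orthogonal idempotents. The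
polynomial of `e_{n+1}(i)` also takes the values required for `e_n(i)`, so the idempotents commute
with the boundary (`permSum_bgs_tupleBoundary`).

The combinatorics concerns arbitrary functions `F u w` of a coefficient `u` and a word `w` over a
commutative monoid, with no linearity in the letters. Chains and cochains enter through the
unitization of `A` as that monoid; symmetry of the bimodule makes both outer faces act on the
coefficient in the same way. The Hodge decomposition is then formal: inclusions and projections
descend to continuous, mutually inverse maps of subquotients. -/

section Words

variable {R V : Type*} [AddCommGroup V] [Module ℂ V]

/-- The value of `f` on the signed shuffle product of the words `x` and `y`. -/
def shuffleSum : (List R → V) → List R → List R → V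
  | f, [], y => f y
  | f, a :: x, [] => f (a :: x)
  | f, a :: x, b :: y => shuffleSum (fun w => f (a :: w)) x (b :: y)
      + (-1 : ℂ) ^ (x.length + 1) • shuffleSum (fun w => f (b :: w)) (a :: x) y
  termination_by _ x y => x.length + y.length

theorem shuffleSum_nil_left (f : List R → V) (y : List R) : shuffleSum f [] y = f y := by
  rw [shuffleSum]

theorem shuffleSum_nil_right (f : List R → V) (x : List R) : shuffleSum f x [] = f x := by
  cases x <;> rw [shuffleSum]

theorem shuffleSum_cons_cons (f : List R → V) (a : R) (x : List R) (b : R) (y : List R) :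
    shuffleSum f (a :: x) (b :: y) = shuffleSum (fun w => f (a :: w)) x (b :: y)
      + (-1 : ℂ) ^ (x.length + 1) • shuffleSum (fun w => f (b :: w)) (a :: x) y := by
  rw [shuffleSum]

theorem shuffleSum_add (f g : List R → V) (x y : List R) :
    shuffleSum (fun w => f w + g w) x y = shuffleSum f x y + shuffleSum g x y := by
  induction x generalizing f g y with
  | nil => simp only [shuffleSum_nil_left]
  | cons a x ihx =>
    induction y generalizing f g with
    | nil => simp only [shuffleSum_nil_right]
    | cons b y ihy =>
      rw [shuffleSum_cons_cons, shuffleSum_cons_cons, shuffleSum_cons_cons, ihx, ihy]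
      module

theorem shuffleSum_smul (c : ℂ) (f : List R → V) (x y : List R) :
    shuffleSum (fun w => c • f w) x y = c • shuffleSum f x y := by
  induction x generalizing f y with
  | nil => simp only [shuffleSum_nil_left]
  | cons a x ihx =>
    induction y generalizing f with
    | nil => simp only [shuffleSum_nil_right]
    | cons b y ihy => rw [shuffleSum_cons_cons, shuffleSum_cons_cons, ihx, ihy]; module

/-- The sum of `G x y` over all ways to cut a word into `x` and `y`. -/
def cutSum : (List R → List R → V) → List R → V
  | G, [] => G [] []
  | G, a :: w => G [] (a :: w) + cutSum (fun x y => G (a :: x) y) w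

theorem cutSum_add (G H : List R → List R → V) (w : List R) :
    cutSum (fun x y => G x y + H x y) w = cutSum G w + cutSum H w := by
  induction w generalizing G H with
  | nil => rfl
  | cons a w ih => simp only [cutSum, ih]; abel

theorem cutSum_smul (c : ℂ) (G : List R → List R → V) (w : List R) :
    cutSum (fun x y => c • G x y) w = c • cutSum G w := by
  induction w generalizing G with
  | nil => rfl
  | cons a w ih => simp only [cutSum, ih, smul_add]

theorem cutSum_eq_sum_range (G : List R → List R → V) (w : List R) :
    cutSum G w = ∑ p ∈ Finset.range (w.length + 1), G (w.take p) (w.drop p) := by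
  induction w generalizing G with
  | nil => simp [cutSum]
  | cons a w ih =>
    rw [cutSum, ih, List.length_cons, Finset.sum_range_succ' _ (w.length + 1)]
    simp [add_comm]

/-- The value of `F` on the first face `a₁ ⊗ (a₂, …, aₙ)` of a word. -/
def firstFace (F : R → List R → V) : List R → V
  | [] => 0
  | a :: w => F a w

/-! ### The boundary of a word, and its compatibility with cutting and shuffling. -/

variable [CommMonoid R]

/-- Multiply the letter `a` into the first letter of a word, or into the coefficient
if the word is empty. -/
def absorb (F : R → List R → V) (a : R) : List R → V
  | [] => F a []
  | c :: w => F 1 ((a * c) :: w)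

/-- The value of `F` on the part of the Hochschild boundary of a word that consists of all faces
but the first. -/
def laterFaces : (R → List R → V) → List R → V
  | _, [] => 0
  | F, a :: w => -absorb F a w - laterFaces (fun u l => F u (a :: l)) w

/-- The value of `F` on the Hochschild boundary of a word. -/
def wordBoundary (F : R → List R → V) (w : List R) : V := firstFace F w + laterFaces F w

theorem laterFaces_add (F G : R → List R → V) (w : List R) :
    laterFaces (fun u l => F u l + G u l) w = laterFaces F w + laterFaces G w := by
  induction w generalizing F G with
  | nil => simp [laterFaces]
  | cons a w ih =>
    have : absorb (fun u l => F u l + G u l) a w = absorb F a w + absorb G a w := by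
      cases w <;> rfl
    simp only [laterFaces, ih, this]; abel

theorem laterFaces_smul (c : ℂ) (F : R → List R → V) (w : List R) :
    laterFaces (fun u l => c • F u l) w = c • laterFaces F w := by
  induction w generalizing F with
  | nil => simp [laterFaces]
  | cons a w ih =>
    have : absorb (fun u l => c • F u l) a w = c • absorb F a w := by
      cases w <;> rfl
    simp only [laterFaces, ih, this]; module

theorem laterFaces_sub (F G : R → List R → V) (w : List R) :
    laterFaces (fun u l => F u l - G u l) w = laterFaces F w - laterFaces G w := by
  have := laterFaces_add F (fun u l => (-1 : ℂ) • G u l) w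
  rw [laterFaces_smul] at this
  simpa [sub_eq_add_neg] using this

theorem laterFaces_neg (F : R → List R → V) (w : List R) :
    laterFaces (fun u l => - F u l) w = - laterFaces F w := by
  simpa using laterFaces_smul (-1) F w

/-- Every face has one letter fewer than `w`. This makes the length-dependent sign of
`shuffleSum_cons_cons` constant over the faces, so that it can be pulled out. -/
theorem laterFaces_congr {F G : R → List R → V} {w : List R}
    (h : ∀ u l, l.length + 1 = w.length → F u l = G u l) : laterFaces F w = laterFaces G w := by
  induction w generalizing F G with
  | nil => rfl
  | cons a w ih =>
    simp only [laterFaces]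
    rw [ih fun u l hl => h u (a :: l) (by simpa using hl)]
    congr 2
    cases w with
    | nil => exact h _ _ rfl
    | cons c w => exact h _ _ rfl

theorem shuffleSum_firstFace (F : R → List R → V) (x y : List R) :
    shuffleSum (firstFace F) x y = firstFace (fun u z => shuffleSum (F u) z y) x
      + (-1 : ℂ) ^ x.length • firstFace (fun u z => shuffleSum (F u) x z) y := by
  cases x with
  | nil => cases y <;> simp [shuffleSum_nil_left, firstFace]
  | cons a x =>
    cases y with
    | nil => simp [shuffleSum_nil_right, firstFace]
    | cons b y => simp [shuffleSum_cons_cons, firstFace]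

/-- After `a`, the next letter comes from `x` or is `b`. Multiplying `a` into `x` before shuffling
misses the mixed product `a * b` and wrongly includes the words in which `b` precedes that product;
the bracket corrects both. `shuffleSum_absorb_right` is the mirror case. -/
theorem shuffleSum_absorb_left (F : R → List R → V) (a : R) (x : List R) (b : R) (y : List R) :
    shuffleSum (absorb F a) x (b :: y)
      = absorb (fun u z => shuffleSum (F u) z (b :: y)) a x
        + (-1 : ℂ) ^ x.length • (shuffleSum (fun w => F 1 ((a * b) :: w)) x y
          - absorb (fun u z => shuffleSum (fun w => F u (b :: w)) z y) a x) := by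
  cases x with
  | nil => simp [shuffleSum_nil_left, absorb]
  | cons c x =>
    simp only [shuffleSum_cons_cons, absorb, List.length_cons]
    module

theorem shuffleSum_absorb_right (F : R → List R → V) (b : R) (a : R) (x : List R) (y : List R) :
    shuffleSum (absorb F b) (a :: x) y
      = shuffleSum (fun w => F 1 ((b * a) :: w)) x y
        + (absorb (fun u z => shuffleSum (F u) (a :: x) z) b y
          - absorb (fun u z => shuffleSum (fun w => F u (a :: w)) x z) b y) := by
  cases y with
  | nil => simp [shuffleSum_nil_right, absorb]
  | cons c y =>
    simp only [shuffleSum_cons_cons, absorb, add_sub_cancel_left]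

/-- The induction splits by which word supplies the first letter. Faces that multiply letters of the
same word give the right-hand side. The mixed products `a * b` and `b * a` have opposite signs and
cancel by commutativity. -/
theorem shuffleSum_laterFaces (F : R → List R → V) (x y : List R) :
    shuffleSum (laterFaces F) x y = laterFaces (fun u z => shuffleSum (F u) z y) x
      + (-1 : ℂ) ^ x.length • laterFaces (fun u z => shuffleSum (F u) x z) y := by
  induction x generalizing F y with
  | nil => simp [shuffleSum_nil_left, laterFaces]
  | cons a x ihx =>
    induction y generalizing F with
    | nil => simp [shuffleSum_nil_right, laterFaces]
    | cons b y ihy =>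
      have hneg : ∀ (f g : List R → V) (x y : List R), shuffleSum (fun w => -f w - g w) x y
          = -shuffleSum f x y - shuffleSum g x y := by
        intro f g x y
        have := shuffleSum_smul (-1 : ℂ) (fun w => f w + g w) x y
        rw [shuffleSum_add] at this
        simpa [neg_add, sub_eq_add_neg, add_comm] using this
      have h : ((-1 : ℂ) ^ (x.length + 1)) * (-1) ^ (x.length + 1) = 1 := by
        rw [← mul_pow]; simp
      have hx : laterFaces (fun u z => shuffleSum (F u) (a :: z) (b :: y)) x
          = laterFaces (fun u z => shuffleSum (fun w => F u (a :: w)) z (b :: y)) x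
            + (-1 : ℂ) ^ x.length • laterFaces
              (fun u z => shuffleSum (fun w => F u (b :: w)) (a :: z) y) x := by
        rw [← laterFaces_smul, ← laterFaces_add]
        refine laterFaces_congr fun u l hl => ?_
        rw [shuffleSum_cons_cons, hl]
      have hy : laterFaces (fun u z => shuffleSum (F u) (a :: x) (b :: z)) y
          = laterFaces (fun u z => shuffleSum (fun w => F u (a :: w)) x (b :: z)) y
            + (-1 : ℂ) ^ (x.length + 1) • laterFaces
              (fun u z => shuffleSum (fun w => F u (b :: w)) (a :: x) z) y := by
        rw [← laterFaces_smul, ← laterFaces_add]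
        refine laterFaces_congr fun u l hl => ?_
        rw [shuffleSum_cons_cons]
      rw [shuffleSum_cons_cons]
      simp only [laterFaces, List.length_cons] at ihx ihy ⊢
      rw [hneg, hneg, shuffleSum_absorb_left, shuffleSum_absorb_right, ihx, ihy, hx, hy,
        mul_comm b a]
      simp only [laterFaces, smul_add, smul_sub, smul_neg, smul_smul, h, one_smul]
      module

theorem shuffleSum_wordBoundary (F : R → List R → V) (x y : List R) :
    shuffleSum (wordBoundary F) x y = wordBoundary (fun u z => shuffleSum (F u) z y) x
      + (-1 : ℂ) ^ x.length • wordBoundary (fun u z => shuffleSum (F u) x z) y := by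
  have := shuffleSum_add (firstFace F) (laterFaces F) x y
  rw [shuffleSum_firstFace, shuffleSum_laterFaces] at this
  refine this.trans ?_
  simp only [wordBoundary]
  module

/-- Only the right piece keeps its first face. That face absorbs the letter just after the cut, and
it cancels the last face of the left piece at the next cut, which absorbs the same letter with the
opposite sign. -/
theorem cutSum_laterFaces (F : R → List R → List R → V) (w : List R) :
    cutSum (fun x y => laterFaces (fun u z => F u z y) x
        + (-1 : ℂ) ^ x.length • wordBoundary (fun u z => F u x z) y) w
      = laterFaces (fun u z => cutSum (F u) z) w := by
  induction w generalizing F with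
  | nil => simp [cutSum, laterFaces, wordBoundary, firstFace]
  | cons a v ih =>
    have h1 : cutSum (fun x y => laterFaces (fun u z => F u z y) (a :: x)
        + (-1 : ℂ) ^ (a :: x).length • wordBoundary (fun u z => F u (a :: x) z) y) v
        = - cutSum (fun x y => absorb (fun u z => F u z y) a x) v
          - laterFaces (fun u z => cutSum (fun x y => F u (a :: x) y) z) v := by
      have e := cutSum_smul (-1 : ℂ) (fun x y => absorb (fun u z => F u z y) a x
        + (laterFaces (fun u z => F u (a :: z) y) x
          + (-1 : ℂ) ^ x.length • wordBoundary (fun u z => F u (a :: x) z) y)) v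
      rw [cutSum_add, ih (fun u x y => F u (a :: x) y)] at e
      rw [sub_eq_add_neg, ← neg_add, ← neg_one_smul ℂ (_ + _), ← e]
      congr 1
      funext x y
      simp only [laterFaces, List.length_cons]
      module
    rw [cutSum, h1]
    simp only [laterFaces, cutSum, wordBoundary, firstFace, laterFaces_add]
    cases v with
    | nil => simp [absorb, cutSum, laterFaces]
    | cons c v => simp only [absorb, cutSum, laterFaces]; simp; abel

/-- The derivation property turns the left side into faces of the two pieces. First faces of left
pieces add up to the first face of `w`, and `cutSum_laterFaces` handles the rest. -/
theorem cutSum_shuffleSum_wordBoundary (F : R → List R → V) (w : List R) :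
    cutSum (shuffleSum (wordBoundary F)) w
      = wordBoundary (fun u z => cutSum (shuffleSum (F u)) z) w := by
  have h : ∀ (G : R → List R → List R → V) (w : List R),
      cutSum (fun x y => firstFace (fun u z => G u z y) x) w
        = firstFace (fun u z => cutSum (G u) z) w := by
    intro G w
    cases w with
    | nil => rfl
    | cons a w => simp [cutSum, firstFace]
  rw [wordBoundary, ← h, ← cutSum_laterFaces, ← cutSum_add]
  congr 1
  funext x y
  rw [shuffleSum_wordBoundary, wordBoundary]
  abel

theorem wordBoundary_wordBoundary (F : R → List R → V) (w : List R) :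
    wordBoundary (fun u z => wordBoundary (fun v l => F (u * v) l) z) w = 0 := by
  induction w generalizing F with
  | nil => simp [wordBoundary, firstFace, laterFaces]
  | cons a v ih =>
    have e := ih (fun u l => F u (a :: l))
    simp only [wordBoundary, firstFace, laterFaces, laterFaces_add, laterFaces_sub, laterFaces_neg]
      at e ⊢
    -- Words with one, two and at least three letters differ in whether `absorb` multiplies into a
    -- letter or into the coefficient.
    cases v with
    | nil => simp [absorb, laterFaces]
    | cons c v =>
      simp only [absorb, laterFaces, laterFaces_sub, laterFaces_neg,
        one_mul] at e ⊢
      cases v with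
      | nil => simp [laterFaces, mul_comm]
      | cons d v =>
        simp [absorb, laterFaces, mul_comm, mul_left_comm] at e ⊢
        refine Eq.trans ?_ e
        abel

end Words

/-! ### Shuffle permutations -/

section Shuffles

open Equiv

/-- The `(p, n - p)`-shuffles in `Sₙ`. -/
def shuffles (n p : ℕ) : Finset (Perm (Fin n)) :=
  {σ : Perm (Fin n) | (∀ i j : Fin n, i < j → (j : ℕ) < p → σ i < σ j) ∧
        (∀ i j : Fin n, i < j → p ≤ (i : ℕ) → σ i < σ j)}

theorem mem_shuffles {n p : ℕ} {σ : Perm (Fin n)} : σ ∈ shuffles n p ↔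
    (∀ i j : Fin n, i < j → (j : ℕ) < p → σ i < σ j) ∧
        (∀ i j : Fin n, i < j → p ≤ (i : ℕ) → σ i < σ j) := by
  simp [shuffles]

theorem perm_eq_one_of_strictMono {n : ℕ} {σ : Perm (Fin n)} (h : StrictMono σ) : σ = 1 := by
  have : h.orderIsoOfSurjective σ σ.surjective = OrderIso.refl _ := Subsingleton.elim _ _
  exact Equiv.ext fun i => congrArg (fun e : Fin n ≃o Fin n => e i) this

theorem shuffles_zero (n : ℕ) : shuffles n 0 = {1} := by
  ext σ
  rw [mem_shuffles, Finset.mem_singleton]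
  refine ⟨fun h => perm_eq_one_of_strictMono fun i j hij => h.2 i j hij (Nat.zero_le _), ?_⟩
  rintro rfl
  exact ⟨fun i j h _ => h, fun i j h _ => h⟩

theorem shuffles_self (n : ℕ) : shuffles n n = {1} := by
  ext σ
  rw [mem_shuffles, Finset.mem_singleton]
  refine ⟨fun h => perm_eq_one_of_strictMono fun i j hij => h.1 i j hij j.2, ?_⟩
  rintro rfl
  exact ⟨fun i j h _ => h, fun i j h _ => h⟩

/-- The permutation that moves `i` to `0` and acts as `σ` on the other letters. -/
def insertPerm {n : ℕ} (i : Fin (n + 1)) (σ : Perm (Fin n)) : Perm (Fin (n + 1)) :=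
  Perm.decomposeFin.symm (0, σ) * i.cycleRange

theorem insertPerm_self {n : ℕ} (i : Fin (n + 1)) (σ : Perm (Fin n)) : insertPerm i σ i = 0 := by
  simp [insertPerm]

theorem insertPerm_succAbove {n : ℕ} (i : Fin (n + 1)) (σ : Perm (Fin n)) (k : Fin n) :
    insertPerm i σ (i.succAbove k) = (σ k).succ := by
  simp [insertPerm]

theorem sign_insertPerm {n : ℕ} (i : Fin (n + 1)) (σ : Perm (Fin n)) :
    Perm.sign (insertPerm i σ) = (-1) ^ (i : ℕ) * Perm.sign σ := by
  rw [insertPerm, Perm.sign_mul, Fin.sign_cycleRange, Perm.decomposeFin.symm_sign]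
  simp [mul_comm]

theorem insertPerm_bijective (n : ℕ) :
    Function.Bijective fun q : Fin (n + 1) × Perm (Fin n) => insertPerm q.1 q.2 := by
  rw [Fintype.bijective_iff_injective_and_card]
  refine ⟨?_, Fintype.card_congr Perm.decomposeFin.symm⟩
  rintro ⟨i, σ⟩ ⟨j, τ⟩ h
  dsimp only at h
  have hij : i = j := by
    apply (insertPerm i σ).injective
    rw [insertPerm_self, h, insertPerm_self]
  subst hij
  rw [insertPerm, insertPerm, mul_left_inj, Equiv.apply_eq_iff_eq] at h
  simpa using h

/-- A shuffle is increasing on each block, so the letter it moves to the front is the first letter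
of a block: `0` for the left one, `q + 1` for the right one. Deleting it leaves a shuffle of the
shortened blocks. -/
theorem insertPerm_mem_shuffles {n : ℕ} (q : Fin n) (i : Fin (n + 1)) (σ : Perm (Fin n)) :
    insertPerm i σ ∈ shuffles (n + 1) (q + 1) ↔
      (i = 0 ∧ σ ∈ shuffles n q) ∨ (i = q.succ ∧ σ ∈ shuffles n (q + 1)) := by
  have h0 : ∀ k : Fin n, insertPerm 0 σ k.succ = (σ k).succ := fun k => by
    rw [← insertPerm_succAbove, Fin.zero_succAbove]
  have hlt : ∀ k : Fin n, (k : ℕ) ≤ q → insertPerm q.succ σ k.castSucc = (σ k).succ := fun k hk => by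
    rw [← insertPerm_succAbove q.succ,
      Fin.succAbove_of_castSucc_lt _ _ (by rw [Fin.lt_def]; simp; omega)]
  have hgt : ∀ k : Fin n, (q : ℕ) < k → insertPerm q.succ σ k.succ = (σ k).succ := fun k hk => by
    rw [← insertPerm_succAbove q.succ,
      Fin.succAbove_of_le_castSucc _ _ (by rw [Fin.le_def]; simp; omega)]
  constructor
  · intro h
    rw [mem_shuffles] at h
    have hi : i = 0 ∨ i = q.succ := by
      by_contra! hne
      rcases lt_or_ge (i : ℕ) (q + 1) with hiq | hiq
      · have := h.1 0 i (Fin.pos_of_ne_zero hne.1) hiq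
        rw [insertPerm_self] at this
        exact absurd this (Fin.not_lt_zero _)
      · have hlt' : q.succ < i := lt_of_le_of_ne (by rw [Fin.le_def]; simpa using hiq) hne.2.symm
        have := h.2 q.succ i hlt' (by simp)
        rw [insertPerm_self] at this
        exact absurd this (Fin.not_lt_zero _)
    rcases hi with rfl | rfl
    · refine Or.inl ⟨rfl, mem_shuffles.2 ⟨fun k l hkl hl => ?_, fun k l hkl hk => ?_⟩⟩
      · simpa [h0] using h.1 k.succ l.succ (by simpa using hkl) (by simpa using hl)
      · simpa [h0] using h.2 k.succ l.succ (by simpa using hkl) (by simpa using hk)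
    · refine Or.inr ⟨rfl, mem_shuffles.2 ⟨fun k l hkl hl => ?_, fun k l hkl hk => ?_⟩⟩
      · have := h.1 k.castSucc l.castSucc (by simpa using hkl) (by simpa using hl)
        rw [Fin.lt_def] at hkl
        rw [hlt k (by omega), hlt l (by omega)] at this
        simpa using this
      · have := h.2 k.succ l.succ (by simpa using hkl) (by simp; omega)
        rw [Fin.lt_def] at hkl
        rw [hgt k (by omega), hgt l (by omega)] at this
        simpa using this
  · rintro (⟨rfl, h⟩ | ⟨rfl, h⟩)
    · rw [mem_shuffles] at h ⊢
      refine ⟨fun k l hkl hl => ?_, fun k l hkl hk => ?_⟩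
      · induction l using Fin.cases with
        | zero => exact absurd hkl (Fin.not_lt_zero _)
        | succ l =>
          induction k using Fin.cases with
          | zero => rw [insertPerm_self, h0]; exact Fin.succ_pos _
          | succ k =>
            rw [h0, h0, Fin.succ_lt_succ_iff]
            exact h.1 k l (by simpa using hkl) (by simpa using hl)
      · induction l using Fin.cases with
        | zero => exact absurd hkl (Fin.not_lt_zero _)
        | succ l =>
          induction k using Fin.cases with
          | zero => simp at hk
          | succ k =>
            rw [h0, h0, Fin.succ_lt_succ_iff]
            exact h.2 k l (by simpa using hkl) (by simpa using hk)
    · rw [mem_shuffles] at h ⊢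
      refine ⟨fun k l hkl hl => ?_, fun k l hkl hk => ?_⟩
      · rw [Fin.lt_def] at hkl
        obtain ⟨k, rfl⟩ : ∃ k' : Fin n, k = k'.castSucc := ⟨⟨k, by omega⟩, rfl⟩
        obtain ⟨l, rfl⟩ : ∃ l' : Fin n, l = l'.castSucc := ⟨⟨l, by omega⟩, rfl⟩
        simp only [Fin.val_castSucc] at hkl hl
        rw [hlt k (by omega), hlt l (by omega), Fin.succ_lt_succ_iff]
        exact h.1 k l hkl hl
      · rw [Fin.lt_def] at hkl
        induction l using Fin.cases with
        | zero => simp at hkl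
        | succ l =>
          simp only [Fin.val_succ] at hkl
          rw [hgt l (by omega)]
          by_cases hkq : k = q.succ
          · rw [hkq, insertPerm_self]; exact Fin.succ_pos _
          · have hne : (k : ℕ) ≠ q + 1 := fun e => hkq (Fin.ext (by simpa using e))
            induction k using Fin.cases with
            | zero => simp at hk
            | succ k =>
              simp only [Fin.val_succ] at hkl hk hne
              rw [hgt k (by omega), Fin.succ_lt_succ_iff]
              exact h.2 k l (by rw [Fin.lt_def]; omega) (by omega)

/-- This is the recursion of `shuffleSum` for two nonempty blocks, and Pascal's rule when `g` is
constant. -/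
theorem sum_shuffles_succ {V : Type*} [AddCommMonoid V] {n : ℕ} (q : Fin n)
    (g : Perm (Fin (n + 1)) → V) :
    ∑ σ ∈ shuffles (n + 1) (q + 1), g σ
      = ∑ σ ∈ shuffles n q, g (insertPerm 0 σ)
        + ∑ σ ∈ shuffles n (q + 1), g (insertPerm q.succ σ) := by
  classical
  have h : ∑ σ ∈ shuffles (n + 1) (q + 1), g σ
      = ∑ r : Fin (n + 1) × Perm (Fin n), ((if r.1 = 0 then if r.2 ∈ shuffles n q then
          g (insertPerm 0 r.2) else 0 else 0) + if r.1 = q.succ then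
          if r.2 ∈ shuffles n (q + 1) then g (insertPerm q.succ r.2) else 0 else 0) := by
    rw [show shuffles (n + 1) (q + 1) = Finset.univ.filter (· ∈ shuffles (n + 1) (q + 1)) by simp,
      Finset.sum_filter,
      ← (insertPerm_bijective n).sum_comp]
    refine Finset.sum_congr rfl fun r _ => ?_
    obtain ⟨i, σ⟩ := r
    simp only [insertPerm_mem_shuffles]
    by_cases h0 : i = 0
    · have : i ≠ q.succ := by rw [h0]; exact (Fin.succ_ne_zero q).symm
      subst h0
      simp [this]
    · by_cases h1 : i = q.succ <;> simp [h0, h1]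
  rw [h, Finset.sum_add_distrib, Fintype.sum_prod_type, Fintype.sum_prod_type]
  simp [Finset.sum_ite_irrel, Finset.sum_ite_mem]

theorem card_shuffles {n p : ℕ} (hp : p ≤ n) : (shuffles n p).card = n.choose p := by
  induction n generalizing p with
  | zero =>
    obtain rfl : p = 0 := by omega
    simp [shuffles_zero]
  | succ n ih =>
    rcases Nat.eq_zero_or_pos p with rfl | hpos
    · simp [shuffles_zero]
    · rcases hp.eq_or_lt with rfl | hlt
      · simp [shuffles_self]
      · obtain ⟨q, rfl⟩ : ∃ q, p = q + 1 := ⟨p - 1, by omega⟩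
        have := sum_shuffles_succ (⟨q, by omega⟩ : Fin n) (fun _ => 1)
        simp only [Finset.sum_const, smul_eq_mul, mul_one] at this
        rw [this, ih (by omega), ih (by omega), Nat.choose_succ_succ]

/-- The number of terms of `shuffleElement n` is the node `λ_n`; this is where the eigenvalue comes
from. -/
theorem sum_card_shuffles {n : ℕ} (hn : n ≠ 0) :
    ((∑ p ∈ Finset.Ioo 0 n, (shuffles n p).card : ℕ) : ℚ) = 2 ^ n - 2 := by
  have h := Nat.sum_range_choose n
  obtain ⟨m, rfl⟩ := Nat.exists_eq_succ_of_ne_zero hn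
  rw [Finset.sum_congr rfl fun p hp => card_shuffles (Finset.mem_Ioo.1 hp).2.le]
  have e : Finset.range (m + 1 + 1) = insert 0 (insert (m + 1) (Finset.Ioo 0 (m + 1))) := by
    ext k; simp only [Finset.mem_range, Finset.mem_insert, Finset.mem_Ioo]; omega
  rw [Nat.succ_eq_add_one, e, Finset.sum_insert (by simp), Finset.sum_insert (by simp)] at h
  simp only [Nat.choose_zero_right, Nat.choose_self] at h
  rw [eq_sub_iff_add_eq]
  exact_mod_cast (by omega :
    ∑ p ∈ Finset.Ioo 0 (m + 1), (m + 1).choose p + 2 = 2 ^ (m + 1))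

theorem ofFn_insertPerm {R : Type*} {n : ℕ} (i : Fin (n + 1)) (σ : Perm (Fin n))
    (a : Fin (n + 1) → R) :
    (List.ofFn fun k => a ((insertPerm i σ)⁻¹ k))
      = a i :: List.ofFn fun k => i.removeNth a (σ⁻¹ k) := by
  rw [List.ofFn_succ]
  congr 2
  · rw [Perm.inv_eq_iff_eq, insertPerm_self]
  · funext k
    rw [Fin.removeNth_apply]
    congr 1
    rw [Perm.inv_eq_iff_eq, insertPerm_succAbove]; simp

theorem ofFn_removeNth {R : Type*} {n : ℕ} (i : Fin (n + 1)) (a : Fin (n + 1) → R) :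
    List.ofFn (i.removeNth a) = (List.ofFn a).eraseIdx i := by
  refine List.ext_getElem (by simp [List.length_eraseIdx]; omega) fun k h1 h2 => ?_
  simp only [List.getElem_ofFn, List.getElem_eraseIdx, Fin.removeNth_apply, Fin.succAbove,
    Fin.lt_def, Fin.val_castSucc]
  split_ifs <;> rfl

/-! ### Shuffle permutations compute the shuffle product of words. -/

variable {R V : Type*} [AddCommGroup V] [Module ℂ V]

theorem sum_shuffles_eq_shuffleSum {n : ℕ} (f : List R → V) (a : Fin n → R) (x y : List R)
    (h : List.ofFn a = x ++ y) :
    ∑ σ ∈ shuffles n x.length,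
        (((Perm.sign σ : ℤˣ) : ℤ) : ℂ) • f (List.ofFn fun k => a (σ⁻¹ k))
      = shuffleSum f x y := by
  induction n generalizing f x y with
  | zero =>
    simp at h
    obtain ⟨rfl, rfl⟩ := h
    simp [shuffles_zero, shuffleSum_nil_left]
  | succ n ih =>
    cases x with
    | nil =>
      rw [List.nil_append] at h
      simp only [List.length_nil, shuffles_zero, Finset.sum_singleton, shuffleSum_nil_left, ← h]
      simp only [Perm.sign_one, Units.val_one, Int.cast_one, one_smul]; rfl
    | cons c x =>
      cases y with
      | nil =>
        have hl := congrArg List.length h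
        rw [List.append_nil] at h hl
        rw [List.length_ofFn] at hl
        rw [← hl, shuffles_self, Finset.sum_singleton, shuffleSum_nil_right, ← h]
        simp only [Perm.sign_one, Units.val_one, Int.cast_one, one_smul]; rfl
      | cons b y =>
        have hl := congrArg List.length h
        simp only [List.length_ofFn, List.length_append, List.length_cons] at hl
        -- `q.succ` is the position of `b`; bringing that letter to the front costs the sign `(-1) ^
        -- (x.length + 1)`.
        let q : Fin n := ⟨x.length, by omega⟩
        have hc : a 0 = c ∧ List.ofFn ((0 : Fin (n + 1)).removeNth a) = x ++ b :: y := by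
          rw [List.ofFn_succ, List.cons_append, List.cons.injEq] at h
          exact h
        have hb : a q.succ = b ∧ List.ofFn (q.succ.removeNth a) = (c :: x) ++ y := by
          constructor
          · have := congrArg (·[x.length + 1]?) h
            simpa [q, show x.length < n by omega] using this
          · rw [ofFn_removeNth, h]
            simp [q, List.eraseIdx_append_of_length_le]
        rw [shuffleSum_cons_cons, ← ih _ _ x (b :: y) hc.2, ← ih _ _ (c :: x) y hb.2]
        refine (sum_shuffles_succ q _).trans ?_
        simp only [ofFn_insertPerm, sign_insertPerm, hc.1, hb.1, Finset.smul_sum, smul_smul]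
        simp [q]

end Shuffles

/-! ### Permutation sums and the Hochschild boundary on tuples -/

section PermSum

open Equiv

variable {R V : Type*} [AddCommGroup V] [Module ℂ V] {n : ℕ}

/-- Extend a function on tuples of length `n` to words of any length, by zero. -/
noncomputable def onList (f : (Fin n → R) → V) (l : List R) : V :=
  open Classical in if h : l.length = n then f fun i => l.get (i.cast h.symm) else 0

theorem onList_ofFn (f : (Fin n → R) → V) (a : Fin n → R) : onList f (List.ofFn a) = f a := by
  rw [onList, dif_pos (List.length_ofFn)]
  congr 1
  funext i
  simp

/-- The value of `f` at the tuple `a`, acted on by an element of `ℚ Sₙ`. -/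
noncomputable def permSum (x : MonoidAlgebra ℚ (Perm (Fin n))) (f : (Fin n → R) → V)
    (a : Fin n → R) : V :=
  ∑ σ : Perm (Fin n), ((x.coeff σ : ℚ) : ℂ) • f (fun k => a (σ⁻¹ k))

theorem permSum_zero (f : (Fin n → R) → V) : permSum 0 f = 0 := by
  funext a; simp [permSum]

theorem permSum_add (x y : MonoidAlgebra ℚ (Perm (Fin n))) (f : (Fin n → R) → V) :
    permSum (x + y) f = permSum x f + permSum y f := by
  funext a; simp [permSum, add_smul, Finset.sum_add_distrib]

theorem permSum_sum {ι : Type*} (s : Finset ι) (x : ι → MonoidAlgebra ℚ (Perm (Fin n)))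
    (f : (Fin n → R) → V) : permSum (∑ i ∈ s, x i) f = ∑ i ∈ s, permSum (x i) f := by
  classical
  induction s using Finset.induction_on with
  | empty => simp [permSum_zero]
  | insert i s hi ih => rw [Finset.sum_insert hi, Finset.sum_insert hi, permSum_add, ih]

theorem permSum_single (σ : Perm (Fin n)) (r : ℚ) (f : (Fin n → R) → V) (a : Fin n → R) :
    permSum (MonoidAlgebra.single σ r) f a = (r : ℂ) • f (fun k => a (σ⁻¹ k)) := by
  classical
  rw [permSum, Finset.sum_eq_single σ]
  · simp
  · intro τ _ hτ
    simp [hτ.symm]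
  · simp

theorem permSum_one (f : (Fin n → R) → V) : permSum 1 f = f := by
  funext a
  rw [MonoidAlgebra.one_def, permSum_single]
  simp only [Rat.cast_one, one_smul]
  rfl

theorem permSum_smul (r : ℚ) (x : MonoidAlgebra ℚ (Perm (Fin n))) (f : (Fin n → R) → V) :
    permSum (r • x) f = (r : ℂ) • permSum x f := by
  funext a; simp [permSum, Finset.smul_sum, mul_smul]

theorem permSum_add_right (x : MonoidAlgebra ℚ (Perm (Fin n))) (f g : (Fin n → R) → V) :
    permSum x (f + g) = permSum x f + permSum x g := by
  funext a; simp [permSum, Finset.sum_add_distrib]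

theorem permSum_zero_right (x : MonoidAlgebra ℚ (Perm (Fin n))) :
    permSum x (0 : (Fin n → R) → V) = 0 := by
  funext a; simp [permSum]

/-- Permutations act on tuples from the left, hence on functions of tuples from the right, which
reverses the order. -/
theorem permSum_mul (x y : MonoidAlgebra ℚ (Perm (Fin n))) (f : (Fin n → R) → V) :
    permSum (x * y) f = permSum y (permSum x f) := by
  induction x using MonoidAlgebra.induction_linear with
  | zero =>
    rw [zero_mul, permSum_zero, permSum_zero_right]
  | add x x' hx hx' => rw [add_mul, permSum_add, hx, hx', permSum_add, permSum_add_right]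
  | single σ r =>
    induction y using MonoidAlgebra.induction_linear with
    | zero => rw [mul_zero, permSum_zero, permSum_zero]
    | add y y' hy hy' => rw [mul_add, permSum_add, hy, hy', permSum_add]
    | single τ s =>
      funext a
      rw [MonoidAlgebra.single_mul_single, permSum_single, permSum_single, permSum_single,
        smul_smul, mul_comm r s, Rat.cast_mul, mul_inv_rev]
      rfl

theorem shuffleElement_eq (n : ℕ) : shuffleElement n = ∑ p ∈ Finset.Ioo 0 n,
    ∑ σ ∈ shuffles n p, MonoidAlgebra.single σ (((Perm.sign σ : ℤˣ) : ℤ) : ℚ) :=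
  rfl

/-- The cuts with an empty piece, `p = 0` and `p = n`, each return `f` itself and are not part of
the shuffle element. For `n = 0` they coincide, whence `hn`. -/
theorem permSum_shuffleElement (hn : n ≠ 0) (f : List R → V) (a : Fin n → R) :
    permSum (shuffleElement n) (fun b => f (List.ofFn b)) a
      = cutSum (shuffleSum f) (List.ofFn a) - (2 : ℂ) • f (List.ofFn a) := by
  have e : Finset.range (n + 1) = insert 0 (insert n (Finset.Ioo 0 n)) := by
    ext k; simp only [Finset.mem_range, Finset.mem_insert, Finset.mem_Ioo]; omega
  rw [cutSum_eq_sum_range, List.length_ofFn, e, Finset.sum_insert (by simpa using hn.symm),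
    Finset.sum_insert (by simp), List.take_zero, List.drop_zero, shuffleSum_nil_left,
    List.take_of_length_le (by simp), List.drop_of_length_le (by simp), shuffleSum_nil_right,
    shuffleElement_eq, permSum_sum, Finset.sum_apply]
  have h : ∀ p ∈ Finset.Ioo 0 n,
      permSum (∑ σ ∈ shuffles n p, MonoidAlgebra.single σ (((Perm.sign σ : ℤˣ) : ℤ) : ℚ))
        (fun b => f (List.ofFn b)) a
      = shuffleSum f ((List.ofFn a).take p) ((List.ofFn a).drop p) := by
    intro p hp
    rw [Finset.mem_Ioo] at hp
    rw [← sum_shuffles_eq_shuffleSum f a _ _ (List.take_append_drop _ _).symm, permSum_sum,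
      Finset.sum_apply]
    simp only [permSum_single, List.length_take, List.length_ofFn, min_eq_left hp.2.le,
      Rat.cast_intCast]
  rw [Finset.sum_congr rfl h]
  module

/-! ### The boundary on tuples commutes with the shuffle element. -/

variable [CommMonoid R]

/-- The value of `F` on the Hochschild boundary of a tuple; the first argument of `F` is the
coefficient. -/
noncomputable def tupleBoundary (F : R → (Fin n → R) → V) (a : Fin (n + 1) → R) : V :=
  F (a 0) (Fin.tail a)
    + ∑ j : Fin n, (-1 : ℂ) ^ ((j : ℕ) + 1) • F 1 (Fin.contractNth j.castSucc (· * ·) a)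
    + (-1 : ℂ) ^ (n + 1) • F (a (Fin.last n)) (Fin.init a)

theorem tupleBoundary_add (F G : R → (Fin n → R) → V) :
    tupleBoundary (F + G) = tupleBoundary F + tupleBoundary G := by
  funext a
  simp only [tupleBoundary, Pi.add_apply, smul_add, Finset.sum_add_distrib]
  abel

theorem tupleBoundary_smul (c : ℂ) (F : R → (Fin n → R) → V) :
    tupleBoundary (c • F) = c • tupleBoundary F := by
  funext a
  simp only [tupleBoundary, Pi.smul_apply, smul_add, Finset.smul_sum, smul_comm c]

/-- The two outer faces agree and have opposite signs. This settles the lowest degree, where the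
formula `permSum_shuffleElement` is not available. -/
theorem tupleBoundary_eq_zero (F : R → (Fin 0 → R) → V) : tupleBoundary F = 0 := by
  funext a
  have : Fin.init a = Fin.tail a := Subsingleton.elim _ _
  simp [tupleBoundary, this]

theorem contractNth_succ (j : Fin n) (a : Fin (n + 2) → R) :
    Fin.contractNth j.succ.castSucc (· * ·) a
      = Fin.cons (a 0) (Fin.contractNth j.castSucc (· * ·) (Fin.tail a)) := by
  funext k
  induction k using Fin.cases with
  | zero => simp [Fin.contractNth]
  | succ k => simp [Fin.contractNth, Fin.tail]

theorem laterFaces_ofFn (F : R → List R → V) (a : Fin (n + 1) → R) :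
    laterFaces F (List.ofFn a)
      = ∑ j : Fin n, (-1 : ℂ) ^ ((j : ℕ) + 1) •
          F 1 (List.ofFn (Fin.contractNth j.castSucc (· * ·) a))
        + (-1 : ℂ) ^ (n + 1) • F (a (Fin.last n)) (List.ofFn (Fin.init a)) := by
  induction n generalizing F with
  | zero => simp [laterFaces, absorb]
  | succ n ih =>
    have h1 : List.ofFn a = a 0 :: List.ofFn (Fin.tail a) := List.ofFn_succ
    have h2 : List.ofFn (Fin.tail a) = a 1 :: List.ofFn (Fin.tail (Fin.tail a)) := List.ofFn_succ
    have h3 : Fin.contractNth (Fin.castSucc 0) (· * ·) a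
        = Fin.cons (a 0 * a 1) (Fin.tail (Fin.tail a)) := by
      funext k
      induction k using Fin.cases with
      | zero => simp [Fin.contractNth]
      | succ k => simp [Fin.contractNth, Fin.tail]
    have h4 : Fin.init a = Fin.cons (a 0) (Fin.init (Fin.tail a)) := by
      funext k
      induction k using Fin.cases with
      | zero => rfl
      | succ k => rfl
    rw [h1, laterFaces, ih, Fin.sum_univ_succ, h2]
    simp only [contractNth_succ, h3, h4, List.ofFn_cons, absorb, Fin.val_succ, Fin.val_zero]
    have h5 : Fin.tail a (Fin.last n) = a (Fin.last (n + 1)) := rfl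
    have h6 : ∀ G : Fin n → V, ∑ j : Fin n, (-1 : ℂ) ^ ((j : ℕ) + 1 + 1) • G j
        = - ∑ j : Fin n, (-1 : ℂ) ^ ((j : ℕ) + 1) • G j := fun G => by
      rw [← Finset.sum_neg_distrib]
      exact Finset.sum_congr rfl fun j _ => by module
    rw [h5, h6]
    module

theorem wordBoundary_ofFn (F : R → List R → V) (a : Fin (n + 1) → R) :
    wordBoundary F (List.ofFn a) = tupleBoundary (fun u b => F u (List.ofFn b)) a := by
  rw [wordBoundary, laterFaces_ofFn, tupleBoundary, add_assoc]
  rw [List.ofFn_succ]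
  rfl

theorem tupleBoundary_tupleBoundary (F : R → (Fin n → R) → V) (a : Fin (n + 2) → R) :
    tupleBoundary (fun u b => tupleBoundary (fun v c => F (u * v) c) b) a = 0 := by
  have h := wordBoundary_wordBoundary (fun u => onList (F u)) (List.ofFn a)
  rw [wordBoundary_ofFn] at h
  simpa only [wordBoundary_ofFn, onList_ofFn] using h

/-- For `n > 0`, `cutSum_shuffleSum_wordBoundary` carried over to tuples; the correction `-2` is the
same in both degrees. -/
theorem permSum_shuffleElement_tupleBoundary (F : R → (Fin n → R) → V) :
    permSum (shuffleElement (n + 1)) (tupleBoundary F)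
      = tupleBoundary (fun u => permSum (shuffleElement n) (F u)) := by
  funext a
  rcases Nat.eq_zero_or_pos n with rfl | hn
  · rw [tupleBoundary_eq_zero, tupleBoundary_eq_zero, permSum_zero_right]
  · have h1 : tupleBoundary F
        = fun b => wordBoundary (fun u => onList (F u)) (List.ofFn b) := by
      funext b
      simp only [wordBoundary_ofFn, onList_ofFn]
    have h2 : (fun u => permSum (shuffleElement n) (F u))
        = (fun u b => cutSum (shuffleSum (onList (F u))) (List.ofFn b))
          + (-2 : ℂ) • (fun u b => onList (F u) (List.ofFn b) : R → (Fin n → R) → V) := by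
      funext u b
      have := permSum_shuffleElement hn.ne' (onList (F u)) b
      simp only [onList_ofFn] at this
      rw [this]
      simp only [Pi.add_apply, Pi.smul_apply, onList_ofFn]
      module
    rw [h1, permSum_shuffleElement (Nat.succ_ne_zero n), cutSum_shuffleSum_wordBoundary, h2,
      tupleBoundary_add, tupleBoundary_smul, wordBoundary_ofFn, wordBoundary_ofFn]
    simp only [Pi.add_apply, Pi.smul_apply]
    module

theorem permSum_aeval_tupleBoundary (q : Polynomial ℚ) (F : R → (Fin n → R) → V) :
    permSum (Polynomial.aeval (shuffleElement (n + 1)) q) (tupleBoundary F)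
      = tupleBoundary (fun u => permSum (Polynomial.aeval (shuffleElement n) q) (F u)) := by
  induction q using Polynomial.induction_on generalizing F with
  | C r =>
    simp only [Polynomial.aeval_C, Algebra.algebraMap_eq_smul_one, permSum_smul, permSum_one]
    exact (tupleBoundary_smul _ _).symm
  | add p q hp hq =>
    simp only [map_add, permSum_add, hp, hq]
    exact (tupleBoundary_add _ _).symm
  | monomial m r ih =>
    simp only [pow_succ, ← mul_assoc, map_mul (Polynomial.aeval _) (_ * _) Polynomial.X,
      Polynomial.aeval_X, permSum_mul]
    rw [ih, permSum_shuffleElement_tupleBoundary]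

end PermSum

/-! ### The spectrum of the total shuffle element -/

section Spectrum

open Equiv Polynomial

variable {n : ℕ}

/-- Two injective words with the same merge at the same place agree up to a transposition. -/
theorem eq_or_eq_swap_of_contractNth_eq (σ τ : Perm (Fin (n + 1))) (i j : Fin n)
    (h : Fin.contractNth i.castSucc (· * ·)
          (fun k => Multiplicative.ofAdd ({σ k} : Multiset (Fin (n + 1))))
        = Fin.contractNth j.castSucc (· * ·)
          (fun k => Multiplicative.ofAdd ({τ k} : Multiset (Fin (n + 1))))) :
    i = j ∧ (σ = τ ∨ σ = τ * swap j.castSucc j.succ) := by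
  have key : ∀ (ρ : Perm (Fin (n + 1))) (i k : Fin n),
      (Fin.contractNth i.castSucc (· * ·)
        (fun k => Multiplicative.ofAdd ({ρ k} : Multiset (Fin (n + 1)))) k).toAdd
      = if k = i then {ρ i.castSucc} + {ρ i.succ} else {ρ (i.succ.succAbove k)} := by
    intro ρ i k
    rcases lt_trichotomy k i with hk | hk | hk
    · rw [if_neg hk.ne, Fin.contractNth_apply_of_lt _ _ _ _ (by simpa using hk),
        Fin.succAbove_of_castSucc_lt _ _ (by rw [Fin.lt_def] at *; simp; omega)]
      rfl
    · subst hk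
      rw [if_pos rfl, Fin.contractNth_apply_of_eq _ _ _ _ (by simp)]
      rfl
    · rw [if_neg hk.ne', Fin.contractNth_apply_of_gt _ _ _ _ (by simpa using hk),
        Fin.succAbove_of_le_castSucc _ _ (by rw [Fin.le_def]; rw [Fin.lt_def] at hk; simp; omega)]
      rfl
  have h' : ∀ k, _ := fun k => congrArg Multiplicative.toAdd (congrFun h k)
  simp only [key] at h'
  -- The merged place is the only one that carries a multiset with two elements.
  have hij : i = j := by
    have := congrArg Multiset.card (h' i)
    by_contra hne
    simp [hne] at this
  subst hij
  refine ⟨rfl, ?_⟩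
  have hne : ∀ k, k ≠ i.castSucc → k ≠ i.succ → σ k = τ k := by
    intro k h1 h2
    obtain ⟨l, rfl⟩ := Fin.exists_succAbove_eq h2
    have hl : l ≠ i := by
      rintro rfl
      apply h1
      rw [Fin.succAbove_of_castSucc_lt _ _ (by rw [Fin.lt_def]; simp)]
    simpa [hl] using h' l
  have hi := h' i
  rw [if_pos rfl, if_pos rfl] at hi
  have hi' : σ i.castSucc = τ i.castSucc ∧ σ i.succ = τ i.succ ∨
      σ i.castSucc = τ i.succ ∧ σ i.succ = τ i.castSucc := by
    have e := hi
    rw [Multiset.singleton_add, Multiset.singleton_add, Multiset.cons_eq_cons] at e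
    rcases e with ⟨e1, e2⟩ | ⟨_, cs, e1, e2⟩
    · exact Or.inl ⟨e1, by simpa using e2⟩
    · have := congrArg Multiset.card e1
      obtain rfl : cs = 0 := by simpa using this
      refine Or.inr ⟨?_, ?_⟩
      · simpa using e2.symm
      · simpa using e1
  rcases hi' with ⟨e1, e2⟩ | ⟨e1, e2⟩
  · left
    ext k : 1
    by_cases h1 : k = i.castSucc
    · rw [h1, e1]
    · by_cases h2 : k = i.succ
      · rw [h2, e2]
      · exact hne k h1 h2
  · right
    ext k : 1
    rw [Perm.mul_apply]
    by_cases h1 : k = i.castSucc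
    · rw [h1, e1, swap_apply_left]
    · by_cases h2 : k = i.succ
      · rw [h2, e2, swap_apply_right]
      · rw [hne k h1 h2, swap_apply_of_ne_of_ne h1 h2]

/-- The two exchanged letters are multiplied together, and the monoid is commutative. -/
theorem contractNth_mul_swap (τ : Perm (Fin (n + 1))) (j : Fin n) :
    Fin.contractNth j.castSucc (· * ·)
        (fun k => Multiplicative.ofAdd
          ({(τ * swap j.castSucc j.succ) k} : Multiset (Fin (n + 1))))
      = Fin.contractNth j.castSucc (· * ·)
          (fun k => Multiplicative.ofAdd ({τ k} : Multiset (Fin (n + 1)))) := by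
  funext k
  rcases lt_trichotomy k j with hk | hk | hk
  · rw [Fin.contractNth_apply_of_lt _ _ _ _ (by simpa using hk),
      Fin.contractNth_apply_of_lt _ _ _ _ (by simpa using hk), Perm.mul_apply,
      swap_apply_of_ne_of_ne]
    · simpa using hk.ne
    · rw [Fin.lt_def] at hk
      intro e
      have := congrArg Fin.val e
      simp at this
      omega
  · subst hk
    rw [Fin.contractNth_apply_of_eq _ _ _ _ (by simp),
      Fin.contractNth_apply_of_eq _ _ _ _ (by simp), Perm.mul_apply, Perm.mul_apply,
      swap_apply_left, swap_apply_right]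
    exact mul_comm _ _
  · rw [Fin.contractNth_apply_of_gt _ _ _ _ (by simpa using hk),
      Fin.contractNth_apply_of_gt _ _ _ _ (by simpa using hk), Perm.mul_apply,
      swap_apply_of_ne_of_ne]
    · rw [Fin.lt_def] at hk
      intro e
      have := congrArg Fin.val e
      simp at this
      omega
    · simpa using hk.ne'

/-- An element of `ℚ Sₙ₊₁` that is annihilated by the Hochschild boundary of a free commutative
monoid changes sign under adjacent transpositions (Barr). -/
theorem coeff_swap_mul_of_permSum_eq_zero (x : MonoidAlgebra ℚ (Perm (Fin (n + 1))))
    (hx : ∀ F : Multiplicative (Multiset (Fin (n + 1))) →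
      (Fin n → Multiplicative (Multiset (Fin (n + 1)))) → ℂ, permSum x (tupleBoundary F) = 0)
    (σ : Perm (Fin (n + 1))) (j : Fin n) :
    x.coeff (swap j.castSucc j.succ * σ) = - x.coeff σ := by
  classical
  let w : Perm (Fin (n + 1)) → Fin (n + 1) → Multiplicative (Multiset (Fin (n + 1))) :=
    fun τ k => Multiplicative.ofAdd {τ k}
  -- The indicator of coefficient `1` together with the word of `σ⁻¹` merged at `j`. The outer faces
  -- have a letter as coefficient, which is never `1`, so `F` sees only the merging faces.
  let F : Multiplicative (Multiset (Fin (n + 1))) →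
      (Fin n → Multiplicative (Multiset (Fin (n + 1)))) → ℂ := fun u b =>
    if u = 1 ∧ b = Fin.contractNth j.castSucc (· * ·) (w σ⁻¹) then 1 else 0
  have hw : ∀ τ k, w τ k ≠ 1 := fun τ k e => by
    have := congrArg (fun z => Multiset.card (Multiplicative.toAdd z)) e
    simp [w] at this
  have hsw : σ⁻¹ ≠ σ⁻¹ * swap j.castSucc j.succ := by
    intro e
    have := left_eq_mul.1 e
    rw [swap_eq_one_iff] at this
    exact (Fin.castSucc_lt_succ).ne this
  have hF : ∀ τ : Perm (Fin (n + 1)), tupleBoundary F (w τ)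
      = (-1 : ℂ) ^ ((j : ℕ) + 1) *
        ((if τ = σ⁻¹ then 1 else 0) + if τ = σ⁻¹ * swap j.castSucc j.succ then 1 else 0) := by
    intro τ
    have h1 : ∀ k b, F (w τ k) b = 0 := fun k b => by simp [F, hw]
    rw [tupleBoundary, h1, h1, Finset.sum_eq_single j]
    · by_cases e1 : τ = σ⁻¹
      · subst e1
        simp [F, hsw]
      · by_cases e2 : τ = σ⁻¹ * swap j.castSucc j.succ
        · subst e2
          have : Fin.contractNth j.castSucc (· * ·) (w (σ⁻¹ * swap j.castSucc j.succ))
              = Fin.contractNth j.castSucc (· * ·) (w σ⁻¹) := contractNth_mul_swap σ⁻¹ j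
          simp only [F, this, hsw.symm]
          simp
        · have : ¬ Fin.contractNth j.castSucc (· * ·) (w τ)
              = Fin.contractNth j.castSucc (· * ·) (w σ⁻¹) := fun e => by
            rcases (eq_or_eq_swap_of_contractNth_eq τ σ⁻¹ j j e).2 with h | h
            · exact e1 h
            · exact e2 h
          simp [F, e1, e2, this]
    · intro i _ hij
      have : ¬ Fin.contractNth i.castSucc (· * ·) (w τ)
          = Fin.contractNth j.castSucc (· * ·) (w σ⁻¹) := fun e =>
        hij (eq_or_eq_swap_of_contractNth_eq τ σ⁻¹ i j e).1
      simp [F, this]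
    · simp
  -- Evaluated at the identity word, the hypothesis says, up to a nonzero sign, that the
  -- coefficients at `σ` and at the swapped permutation add up to zero.
  have h := congrFun (hx F) (w 1)
  have hinv : ∀ τ : Perm (Fin (n + 1)), (fun k => w 1 (τ⁻¹ k)) = w τ⁻¹ := fun τ => rfl
  have e2 : ∀ τ : Perm (Fin (n + 1)), τ⁻¹ = σ⁻¹ * swap j.castSucc j.succ ↔
      τ = swap j.castSucc j.succ * σ := fun τ => by
    rw [inv_eq_iff_eq_inv, mul_inv_rev, inv_inv, swap_inv]
  simp only [permSum, hinv, hF, inv_inj, e2, smul_eq_mul, mul_add, Finset.sum_add_distrib,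
    mul_ite, mul_one, mul_zero, Finset.sum_ite_eq', Finset.mem_univ, if_true, Pi.zero_apply] at h
  rw [← add_mul] at h
  have h' := (mul_eq_zero.1 h).resolve_right (by simp)
  rw [eq_neg_iff_add_eq_zero, add_comm]
  exact_mod_cast h'

/-- Adjacent transpositions generate the symmetric group. -/
theorem coeff_mul_of_coeff_swap_mul (x : MonoidAlgebra ℚ (Perm (Fin (n + 1))))
    (hx : ∀ (σ : Perm (Fin (n + 1))) (j : Fin n),
      x.coeff (swap j.castSucc j.succ * σ) = - x.coeff σ) (τ σ : Perm (Fin (n + 1))) :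
    x.coeff (τ * σ) = (((Perm.sign τ : ℤˣ) : ℤ) : ℚ) * x.coeff σ := by
  have hτ : τ ∈ Submonoid.closure (Set.range fun i : Fin n => swap i.castSucc i.succ) := by
    rw [Perm.mclosure_swap_castSucc_succ]; trivial
  induction hτ using Submonoid.closure_induction generalizing σ with
  | mem τ h =>
    obtain ⟨j, rfl⟩ := h
    rw [hx, Perm.sign_swap (Fin.castSucc_lt_succ).ne]
    simp
  | one => simp
  | mul τ τ' _ _ h h' => rw [mul_assoc, h, h', Perm.sign_mul]; push_cast; ring

/-- Each signed permutation `sgn(τ) τ` fixes `x`, so the eigenvalue is the number of terms of the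
shuffle element. -/
theorem shuffleElement_mul_of_alternating (x : MonoidAlgebra ℚ (Perm (Fin (n + 1))))
    (hx : ∀ τ σ : Perm (Fin (n + 1)),
      x.coeff (τ * σ) = (((Perm.sign τ : ℤˣ) : ℤ) : ℚ) * x.coeff σ) :
    shuffleElement (n + 1) * x = ((2 : ℚ) ^ (n + 1) - 2) • x := by
  have h : ∀ τ : Perm (Fin (n + 1)),
      MonoidAlgebra.single τ (((Perm.sign τ : ℤˣ) : ℤ) : ℚ) * x = x := by
    intro τ
    ext σ
    have e : σ = τ * (τ⁻¹ * σ) := by group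
    have hsq : (((Perm.sign τ : ℤˣ) : ℤ) : ℚ) * (((Perm.sign τ : ℤˣ) : ℤ) : ℚ) = 1 := by
      rw [← Int.cast_mul, Int.units_coe_mul_self, Int.cast_one]
    conv_rhs => rw [e, hx]
    rw [MonoidAlgebra.coeff_single_mul_eq_mul_coeff (τ⁻¹ * σ)
      fun ρ _ => by rw [eq_inv_mul_iff_mul_eq]]
  rw [shuffleElement_eq, ← sum_card_shuffles (Nat.succ_ne_zero n), Finset.sum_mul]
  simp only [Finset.sum_mul, h, Finset.sum_const, Nat.cast_sum, Finset.sum_smul,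
    Nat.cast_smul_eq_nsmul]

/-- The product up to `n`, evaluated at `shuffleElement (n + 1)`, annihilates all boundaries because
it vanishes at `shuffleElement n`. It is therefore alternating, and the last factor kills it. -/
theorem aeval_shuffleElement_prod (hn : n ≠ 0) :
    aeval (shuffleElement n) (∏ k ∈ Finset.Icc 1 n, (X - C ((2 : ℚ) ^ k - 2))) = 0 := by
  induction n with
  | zero => exact absurd rfl hn
  | succ n ih =>
    rw [Finset.prod_Icc_succ_top (by omega), mul_comm, map_mul, map_sub, aeval_X, aeval_C,
      sub_mul, ← Algebra.smul_def, sub_eq_zero]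
    -- The induction starts at `n + 1 = 1`, where both the shuffle element and `λ_1` are zero.
    rcases Nat.eq_zero_or_pos n with rfl | hpos
    · simp [shuffleElement]
    · apply shuffleElement_mul_of_alternating
      apply coeff_mul_of_coeff_swap_mul
      apply coeff_swap_mul_of_permSum_eq_zero
      intro F
      rw [permSum_aeval_tupleBoundary, ih hpos.ne']
      simp only [permSum_zero]
      have := tupleBoundary_smul (0 : ℂ) F
      rwa [zero_smul, zero_smul] at this

end Spectrum

/-! ### The Eulerian idempotents -/

section Eulerian

open Equiv Polynomial

variable {n : ℕ}

theorem eulerianNode_injective : Function.Injective fun k : ℕ => (2 : ℚ) ^ k - 2 := by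
  intro k l h
  exact pow_right_injective₀ (a := (2 : ℚ)) (by norm_num) (by norm_num) (by simpa using h)

/-- The nodes are distinct, so a polynomial that vanishes at all of them is divisible by the
annihilating product. -/
theorem aeval_shuffleElement_eq_of_eval_eq (hn : n ≠ 0) {p q : ℚ[X]}
    (h : ∀ k ∈ Finset.Icc 1 n, p.eval ((2 : ℚ) ^ k - 2) = q.eval ((2 : ℚ) ^ k - 2)) :
    aeval (shuffleElement n) p = aeval (shuffleElement n) q := by
  have hd : ∏ k ∈ Finset.Icc 1 n, (X - C ((2 : ℚ) ^ k - 2)) ∣ p - q := by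
    refine Finset.prod_dvd_of_coprime
      (fun k _ l _ hkl => pairwise_coprime_X_sub_C eulerianNode_injective hkl) fun k hk => ?_
    rw [dvd_iff_isRoot, IsRoot, eval_sub, h k hk, sub_self]
  obtain ⟨r, hr⟩ := hd
  rw [← sub_eq_zero, ← map_sub, hr, map_mul, aeval_shuffleElement_prod hn, zero_mul]

theorem bgs_of_notMem {i : ℕ} (hi : i ∉ bgsIndex n) : bgs n i = 0 := by
  rw [bgs, if_neg hi]

theorem bgs_zero_zero : bgs 0 0 = 1 := by
  simp [bgs, bgsIndex]

theorem bgsIndex_of_ne_zero (hn : n ≠ 0) : bgsIndex n = Finset.Icc 1 n := if_neg hn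

theorem eval_lagrangeBasis (m i k : ℕ) (hk : k ∈ Finset.Icc 1 m) :
    (Lagrange.basis (Finset.Icc 1 m) (fun k => (2 : ℚ) ^ k - 2) i).eval ((2 : ℚ) ^ k - 2)
      = if i = k then 1 else 0 := by
  split_ifs with hik
  · subst hik
    exact Lagrange.eval_basis_self eulerianNode_injective.injOn hk
  · exact Lagrange.eval_basis_of_ne (v := fun k : ℕ => (2 : ℚ) ^ k - 2) hik hk

/-- This frees `bgs n i` from its particular polynomial. It also covers `i` outside the index set,
where `p` vanishes at every node. -/
theorem bgs_eq_aeval (hn : n ≠ 0) {i : ℕ} {p : ℚ[X]}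
    (hp : ∀ k ∈ Finset.Icc 1 n, p.eval ((2 : ℚ) ^ k - 2) = if i = k then 1 else 0) :
    bgs n i = aeval (shuffleElement n) p := by
  rw [bgs, bgsIndex_of_ne_zero hn]
  split_ifs with hi
  · refine aeval_shuffleElement_eq_of_eval_eq hn fun k hk => ?_
    rw [hp k hk, eval_lagrangeBasis n i k hk]
  · rw [← map_zero (aeval (R := ℚ) (shuffleElement n))]
    refine aeval_shuffleElement_eq_of_eval_eq hn fun k hk => ?_
    rw [hp k hk, if_neg (by rintro rfl; exact hi hk), eval_zero]

theorem bgs_mul_self (n i : ℕ) : bgs n i * bgs n i = bgs n i := by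
  by_cases hi : i ∈ bgsIndex n
  · rcases eq_or_ne n 0 with rfl | hn
    · obtain rfl : i = 0 := by simpa [bgsIndex] using hi
      simp [bgs_zero_zero]
    · rw [bgsIndex_of_ne_zero hn] at hi
      rw [bgs_eq_aeval hn (fun k hk => eval_lagrangeBasis n i k hk), ← map_mul]
      refine aeval_shuffleElement_eq_of_eval_eq hn fun k hk => ?_
      rw [eval_mul, eval_lagrangeBasis n i k hk]
      split_ifs <;> simp
  · simp [bgs_of_notMem hi]

theorem bgs_mul_of_ne (n : ℕ) {i j : ℕ} (hij : i ≠ j) : bgs n i * bgs n j = 0 := by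
  by_cases hi : i ∈ bgsIndex n
  · by_cases hj : j ∈ bgsIndex n
    · rcases eq_or_ne n 0 with rfl | hn
      · simp only [bgsIndex, if_true, Finset.mem_singleton] at hi hj
        exact absurd (hi.trans hj.symm) hij
      · rw [bgsIndex_of_ne_zero hn] at hi hj
        rw [bgs_eq_aeval hn (fun k hk => eval_lagrangeBasis n i k hk),
          bgs_eq_aeval hn (fun k hk => eval_lagrangeBasis n j k hk), ← map_mul,
          ← map_zero (aeval (R := ℚ) (shuffleElement n))]
        refine aeval_shuffleElement_eq_of_eval_eq hn fun k hk => ?_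
        rw [eval_mul, eval_lagrangeBasis n i k hk, eval_lagrangeBasis n j k hk, eval_zero]
        split_ifs with h1 h2
        · exact absurd (h1.trans h2.symm) hij
        all_goals simp
    · simp [bgs_of_notMem hj]
  · simp [bgs_of_notMem hi]

theorem sum_bgs (n : ℕ) : ∑ i ∈ bgsIndex n, bgs n i = 1 := by
  rcases eq_or_ne n 0 with rfl | hn
  · simp [bgsIndex, bgs_zero_zero]
  · have hne : (Finset.Icc 1 n).Nonempty := ⟨1, by simp; omega⟩
    simp only [bgs, ← Finset.sum_filter, Finset.filter_mem_eq_inter, Finset.inter_self]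
    rw [bgsIndex_of_ne_zero hn, ← map_sum,
      Lagrange.sum_basis eulerianNode_injective.injOn hne, map_one]

/-- The Lagrange polynomial for `n + 1` nodes has the right values at the first `n` of them, so a
single polynomial represents both idempotents; for `i = n + 1 > 1` it represents zero in degree `n`.
-/
theorem permSum_bgs_tupleBoundary {R V : Type*} [AddCommGroup V] [Module ℂ V] [CommMonoid R]
    (i : ℕ) (F : R → (Fin n → R) → V) :
    permSum (bgs (n + 1) i) (tupleBoundary F)
      = tupleBoundary (fun u => permSum (bgs n i) (F u)) := by
  have hz : tupleBoundary (fun (_ : R) (_ : Fin n → R) => (0 : V)) = 0 := by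
    funext a; simp [tupleBoundary]
  by_cases hi : i ∈ bgsIndex (n + 1)
  -- The idempotents do not match here, since `e₁(1) = 1` and `e₀(1) = 0`, but the boundary out of
  -- degree one vanishes.
  · rcases eq_or_ne n 0 with rfl | hn
    · rw [tupleBoundary_eq_zero, tupleBoundary_eq_zero, permSum_zero_right]
    · rw [bgsIndex_of_ne_zero (Nat.succ_ne_zero n)] at hi
      rw [bgs_eq_aeval (Nat.succ_ne_zero n) (fun k hk => eval_lagrangeBasis _ i k hk),
        bgs_eq_aeval hn fun k hk => eval_lagrangeBasis (n + 1) i k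
          (Finset.Icc_subset_Icc_right n.le_succ hk), permSum_aeval_tupleBoundary]
  · rw [bgs_of_notMem hi, permSum_zero]
    rcases eq_or_ne n 0 with rfl | hn
    · rw [tupleBoundary_eq_zero]
    · have : i ∉ bgsIndex n := fun h => hi (by
        rw [bgsIndex_of_ne_zero hn] at h
        rw [bgsIndex_of_ne_zero (Nat.succ_ne_zero n)]
        exact Finset.Icc_subset_Icc_right n.le_succ h)
      simp only [bgs_of_notMem this, permSum_zero]
      exact hz.symm

end Eulerian

/-! ### The Hochschild operators as boundaries of tuples -/

section Operators

open Equiv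

theorem map_tupleBoundary {R V W L : Type*} [AddCommGroup V] [Module ℂ V] [AddCommGroup W]
    [Module ℂ W] [FunLike L V W] [LinearMapClass L ℂ V W] [CommMonoid R] {n : ℕ} (l : L)
    (F : R → (Fin n → R) → V)
    (a : Fin (n + 1) → R) :
    l (tupleBoundary F a) = tupleBoundary (fun u b => l (F u b)) a := by
  simp [tupleBoundary]

theorem map_permSum {R V W L : Type*} [AddCommGroup V] [Module ℂ V] [AddCommGroup W]
    [Module ℂ W] [FunLike L V W] [LinearMapClass L ℂ V W] {n : ℕ} (l : L)
    (x : MonoidAlgebra ℚ (Perm (Fin n)))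
    (f : (Fin n → R) → V) (a : Fin n → R) :
    l (permSum x f a) = permSum x (fun b => l (f b)) a := by
  simp [permSum]

theorem groupAlgAct_tprod {A : Type*} [NormedAddCommGroup A] [NormedSpace ℂ A] {n : ℕ}
    (x : MonoidAlgebra ℚ (Perm (Fin n))) (a : Fin n → A) :
    groupAlgAct x (TensorPow.tprod A n a) = permSum x (TensorPow.tprod A n) a := by
  simp [groupAlgAct, permSum, permAct_tprod]

theorem precomp_apply_eq_permSum {A M : Type*} [NormedAddCommGroup A] [NormedSpace ℂ A]
    [NormedAddCommGroup M] [NormedSpace ℂ M] {n : ℕ} (x : MonoidAlgebra ℚ (Perm (Fin n)))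
    (ψ : ContinuousMultilinearMap ℂ (fun _ : Fin n => A) M) (a : Fin n → A) :
    precomp x ψ a = permSum x ψ a := by
  simp [precomp, permSum]
  rfl

namespace Hochschild

theorem chain_ext {A M G : Type*} [NonUnitalNormedRing A] [NormedSpace ℂ A]
    [NormedAddCommGroup M] [NormedSpace ℂ M] [NormedAddCommGroup G] [NormedSpace ℂ G] {n : ℕ}
    {f g : Chain A M n →L[ℂ] G} (h : ∀ m a, f (elem m a) = g (elem m a)) : f = g := by
  refine ProjTensor.ext_tmul fun m t => ?_
  have : f ∘L ProjTensor.tmulL m = g ∘L ProjTensor.tmulL m := TensorPow.ext_tprod (h m)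
  exact DFunLike.congr_fun this t

variable {A M : Type*} [NonUnitalNormedCommRing A] [NormedSpace ℂ A]
  [NormedAddCommGroup M] [NormedSpace ℂ M] {n : ℕ}

theorem chainBGS_elem (i : ℕ) (m : M) (a : Fin n → A) :
    chainBGS A M n i (elem m a) = permSum (bgs n i) (elem m) a := by
  rw [chainBGS, elem, ProjTensor.map_tmul, groupAlgAct_tprod]
  exact map_permSum (ProjTensor.tmulL (F := TensorPow A n) m) _ _ _

theorem chainBGS_permSum (i : ℕ) (x : MonoidAlgebra ℚ (Perm (Fin n))) (m : M) (a : Fin n → A) :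
    chainBGS A M n i (permSum x (elem m) a) = permSum (bgs n i * x) (elem m) a := by
  rw [permSum_mul]
  refine (map_permSum (chainBGS A M n i) _ _ _).trans ?_
  congr 1
  funext b
  exact chainBGS_elem i m b

theorem chainBGS_comp (i j : ℕ) (m : M) (a : Fin n → A) :
    (chainBGS A M n i ∘L chainBGS A M n j) (elem m a)
      = permSum (bgs n i * bgs n j) (elem m) a := by
  rw [ContinuousLinearMap.comp_apply, chainBGS_elem, chainBGS_permSum]

theorem chainBGS_comp_self (n i : ℕ) :
    chainBGS A M n i ∘L chainBGS A M n i = chainBGS A M n i :=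
  chain_ext fun m a => by rw [chainBGS_comp, bgs_mul_self, chainBGS_elem]

theorem chainBGS_comp_of_ne (n : ℕ) {i j : ℕ} (hij : i ≠ j) :
    chainBGS A M n i ∘L chainBGS A M n j = 0 :=
  chain_ext fun m a => by rw [chainBGS_comp, bgs_mul_of_ne n hij, permSum_zero]; rfl

theorem chainBGS_of_notMem {n i : ℕ} (hi : i ∉ bgsIndex n) : chainBGS A M n i = 0 :=
  chain_ext fun m a => by rw [chainBGS_elem, bgs_of_notMem hi, permSum_zero]; rfl

theorem sum_chainBGS (n : ℕ) :
    ∑ i ∈ bgsIndex n, chainBGS A M n i = ContinuousLinearMap.id ℂ (Chain A M n) :=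
  chain_ext fun m a => by
    have := permSum_sum (bgsIndex n) (bgs n) (elem m : (Fin n → A) → Chain A M n)
    rw [sum_bgs, permSum_one] at this
    rw [_root_.sum_apply]
    simp only [chainBGS_elem]
    rw [← Finset.sum_apply, ← this]
    rfl

theorem cochainBGS_apply (i : ℕ) (ψ : Cochain A M n) (a : Fin n → A) :
    cochainBGS A M n i ψ a = permSum (bgs n i) ψ a :=
  precomp_apply_eq_permSum _ _ _

theorem cochainBGS_comp (i j : ℕ) (ψ : Cochain A M n) (a : Fin n → A) :
    (cochainBGS A M n i ∘L cochainBGS A M n j) ψ a = permSum (bgs n j * bgs n i) ψ a := by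
  rw [ContinuousLinearMap.comp_apply, cochainBGS_apply, permSum_mul]
  congr 1
  funext b
  exact cochainBGS_apply j ψ b

theorem cochainBGS_comp_self (n i : ℕ) :
    cochainBGS A M n i ∘L cochainBGS A M n i = cochainBGS A M n i := by
  ext ψ a
  rw [cochainBGS_comp, bgs_mul_self, cochainBGS_apply]

theorem cochainBGS_comp_of_ne (n : ℕ) {i j : ℕ} (hij : i ≠ j) :
    cochainBGS A M n i ∘L cochainBGS A M n j = 0 := by
  ext ψ a
  rw [cochainBGS_comp, bgs_mul_of_ne n hij.symm, permSum_zero]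
  rfl

theorem cochainBGS_of_notMem {n i : ℕ} (hi : i ∉ bgsIndex n) : cochainBGS A M n i = 0 := by
  ext ψ a
  rw [cochainBGS_apply, bgs_of_notMem hi, permSum_zero]
  rfl

theorem sum_cochainBGS (n : ℕ) :
    ∑ i ∈ bgsIndex n, cochainBGS A M n i = ContinuousLinearMap.id ℂ (Cochain A M n) := by
  ext ψ a
  have := permSum_sum (bgsIndex n) (bgs n) (ψ : (Fin n → A) → M)
  rw [sum_bgs, permSum_one] at this
  rw [_root_.sum_apply, _root_.sum_apply]
  simp only [cochainBGS_apply]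
  rw [← Finset.sum_apply, ← this]
  rfl

/-! ### The Hochschild operators as tuple boundaries over the unitization. -/

variable [IsScalarTower ℂ A A] [SMulCommClass ℂ A A]

/-- The action of the unitization of `A` on `M` that extends the right action of `A`. -/
noncomputable def unitAct (X : BanachBimodule A M) (u : Unitization ℂ A) : M →L[ℂ] M :=
  u.fst • ContinuousLinearMap.id ℂ M + X.right u.snd

theorem unitAct_one (X : BanachBimodule A M) (m : M) : unitAct X 1 m = m := by
  simp [unitAct]

theorem unitAct_inr (X : BanachBimodule A M) (a : A) (m : M) :
    unitAct X (Unitization.inr a) m = X.right a m := by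
  simp [unitAct]

theorem unitAct_mul (X : BanachBimodule A M) (u v : Unitization ℂ A) (m : M) :
    unitAct X (u * v) m = unitAct X v (unitAct X u m) := by
  simp [unitAct, X.right_mul, smul_smul]
  module

/-- Products of letters of `A` stay in `A`; the unit is needed only as the coefficient of the middle
faces. Values of `F` on letters outside `A` therefore never matter, and `unitElem` and `unitCochain`
may discard scalar parts. -/
theorem tupleBoundary_inr {V : Type*} [AddCommGroup V] [Module ℂ V]
    (F : Unitization ℂ A → (Fin n → Unitization ℂ A) → V) (a : Fin (n + 1) → A) :
    tupleBoundary F (fun k => (Unitization.inr (a k) : Unitization ℂ A))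
      = F (Unitization.inr (a 0)) (fun k => (Unitization.inr (Fin.tail a k) : Unitization ℂ A))
        + ∑ j : Fin n, (-1 : ℂ) ^ ((j : ℕ) + 1) • F 1
          (fun k => (Unitization.inr (merge j a k) : Unitization ℂ A))
        + (-1 : ℂ) ^ (n + 1) • F (Unitization.inr (a (Fin.last n)))
          (fun k => (Unitization.inr (Fin.init a k) : Unitization ℂ A)) := by
  have h : ∀ j : Fin n, Fin.contractNth j.castSucc (· * ·)
        (fun k => (Unitization.inr (a k) : Unitization ℂ A))
      = fun k => (Unitization.inr (merge j a k) : Unitization ℂ A) := by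
    intro j
    funext k
    simp only [merge, Fin.contractNth]
    split_ifs <;> simp
  simp only [tupleBoundary, h]
  rfl

theorem tupleBoundary_congr_inr {V : Type*} [AddCommGroup V] [Module ℂ V]
    {F G : Unitization ℂ A → (Fin n → Unitization ℂ A) → V}
    (h : ∀ u (b : Fin n → A),
      F u (fun k => Unitization.inr (b k)) = G u (fun k => Unitization.inr (b k)))
    (a : Fin (n + 1) → A) :
    tupleBoundary F (fun k => (Unitization.inr (a k) : Unitization ℂ A))
      = tupleBoundary G (fun k => (Unitization.inr (a k) : Unitization ℂ A)) := by
  simp only [tupleBoundary_inr, h]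

/-- The elementary chain with coefficient `m u`, as a function of `u` and the other letters. -/
noncomputable def unitElem (X : BanachBimodule A M) (n : ℕ) (m : M) (u : Unitization ℂ A)
    (b : Fin n → Unitization ℂ A) : Chain A M n :=
  elem (unitAct X u m) fun k => (b k).snd

/-- Symmetry rewrites the left action in the last face as the right action, so both outer faces
become the action of a coefficient in the unitization. -/
theorem boundary_elem (X : BanachBimodule A M) (hX : X.IsSymmetric) (m : M)
    (a : Fin (n + 1) → A) :
    boundary X n (elem m a)
      = tupleBoundary (unitElem X n m) (fun k => (Unitization.inr (a k) : Unitization ℂ A)) := by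
  rw [tupleBoundary_inr]
  simp [boundary, faceFirst_elem, faceMiddle_elem, faceLast_elem, unitElem, unitAct_one,
    unitAct_inr, hX _ _]

theorem boundary_comp_boundary (X : BanachBimodule A M) (hX : X.IsSymmetric) (n : ℕ) :
    boundary X n ∘L boundary X (n + 1) = 0 := by
  refine chain_ext fun m a => ?_
  rw [ContinuousLinearMap.comp_apply, boundary_elem X hX]
  refine (map_tupleBoundary (boundary X n) _ _).trans ?_
  refine Eq.trans ?_ (tupleBoundary_tupleBoundary (unitElem X n m)
    fun k => (Unitization.inr (a k) : Unitization ℂ A))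
  refine tupleBoundary_congr_inr (fun u b => ?_) a
  refine (boundary_elem X hX _ _).trans ?_
  refine tupleBoundary_congr_inr (fun v c => ?_) b
  rw [unitElem, unitElem, unitAct_mul]

theorem boundary_comp_chainBGS (X : BanachBimodule A M) (hX : X.IsSymmetric) (n i : ℕ) :
    boundary X n ∘L chainBGS A M (n + 1) i = chainBGS A M n i ∘L boundary X n := by
  refine chain_ext fun m a => ?_
  rw [ContinuousLinearMap.comp_apply, ContinuousLinearMap.comp_apply, chainBGS_elem,
    boundary_elem X hX]
  have h1 : boundary X n (permSum (bgs (n + 1) i) (elem m) a)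
      = permSum (bgs (n + 1) i) (tupleBoundary (unitElem X n m))
        (fun k => (Unitization.inr (a k) : Unitization ℂ A)) := by
    refine (map_permSum (boundary X n) _ _ _).trans ?_
    exact Finset.sum_congr rfl fun σ _ => congrArg _ (boundary_elem X hX _ _)
  have h2 : (fun u => permSum (bgs n i) (unitElem X n m u))
      = fun u b => chainBGS A M n i (unitElem X n m u b) := by
    funext u b
    rw [unitElem, chainBGS_elem]
    rfl
  rw [h1, permSum_bgs_tupleBoundary, h2, map_tupleBoundary (chainBGS A M n i)]

/-- The value of a cochain times `u`, as a function of `u` and the letters. -/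
noncomputable def unitCochain (X : BanachBimodule A M) (ψ : Cochain A M n) (u : Unitization ℂ A)
    (b : Fin n → Unitization ℂ A) : M :=
  unitAct X u (ψ fun k => (b k).snd)

theorem coboundary_apply (X : BanachBimodule A M) (hX : X.IsSymmetric) (ψ : Cochain A M n)
    (a : Fin (n + 1) → A) :
    coboundary X n ψ a
      = tupleBoundary (unitCochain X ψ) (fun k => (Unitization.inr (a k) : Unitization ℂ A)) := by
  rw [tupleBoundary_inr]
  have h : ∀ j : Fin n, mergeCompL j ψ a = ψ (merge j a) := fun j => rfl
  simp [coboundary, cofaceFirst_apply, cofaceLast_apply, h, unitCochain, unitAct_one,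
    unitAct_inr, hX _ _]

theorem coboundary_comp_coboundary (X : BanachBimodule A M) (hX : X.IsSymmetric) (n : ℕ) :
    coboundary X (n + 1) ∘L coboundary X n = 0 := by
  ext ψ a
  rw [ContinuousLinearMap.comp_apply, coboundary_apply X hX]
  refine Eq.trans ?_ (tupleBoundary_tupleBoundary (unitCochain X ψ)
    fun k => (Unitization.inr (a k) : Unitization ℂ A))
  refine tupleBoundary_congr_inr (fun u b => ?_) a
  rw [unitCochain]
  refine (congrArg (unitAct X u) (coboundary_apply X hX ψ b)).trans ?_
  refine (map_tupleBoundary (unitAct X u) _ _).trans ?_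
  congr 1
  funext v c
  -- Here `u` acts after `v`, the opposite of the order in `unitAct_mul`.
  rw [unitCochain, unitCochain, mul_comm u v, unitAct_mul]

theorem coboundary_comp_cochainBGS (X : BanachBimodule A M) (hX : X.IsSymmetric) (n i : ℕ) :
    coboundary X n ∘L cochainBGS A M n i = cochainBGS A M (n + 1) i ∘L coboundary X n := by
  ext ψ a
  rw [ContinuousLinearMap.comp_apply, ContinuousLinearMap.comp_apply, cochainBGS_apply,
    coboundary_apply X hX]
  have h1 : permSum (bgs (n + 1) i) (coboundary X n ψ) a
      = permSum (bgs (n + 1) i) (tupleBoundary (unitCochain X ψ))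
        (fun k => (Unitization.inr (a k) : Unitization ℂ A)) :=
    Finset.sum_congr rfl fun σ _ => congrArg _ (coboundary_apply X hX _ _)
  rw [h1, permSum_bgs_tupleBoundary]
  congr 1
  funext u b
  rw [unitCochain, cochainBGS_apply]
  exact map_permSum (unitAct X u) _ _ _

end Hochschild

end Operators

/-! ### Homology of a direct sum of complexes -/

section Decomposition

/-- A subquotient `Z / B` of a normed space is the product of the subquotients cut out by a
complete family of orthogonal projections that preserve it. -/
theorem exists_subquotient_equiv {E : Type*} [NormedAddCommGroup E] [NormedSpace ℂ E]
    {ι : Type*} [Fintype ι] (p : ι → E →L[ℂ] E) (hp : ∀ i x, p i (p i x) = p i x)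
    (hpp : ∀ i j x, i ≠ j → p i (p j x) = 0) (hsum : ∀ x, ∑ i, p i x = x)
    (Z B : Submodule ℂ E) (Zs Bs : ι → Submodule ℂ E)
    (hZs : ∀ i x, x ∈ Zs i ↔ x ∈ Z ∧ p i x = x) (hZ : ∀ i, ∀ x ∈ Z, p i x ∈ Z)
    (hBs : ∀ i, Bs i ≤ B) (hB : ∀ i, ∀ x ∈ B, p i x ∈ Bs i) :
    ∃ Φ : (∀ i, Zs i ⧸ (Bs i).submoduleOf (Zs i)) ≃L[ℂ] Z ⧸ B.submoduleOf Z,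
      ∀ z : ∀ i, Zs i, Φ (fun i => Submodule.Quotient.mk (z i))
        = Submodule.Quotient.mk (∑ i, ⟨z i, ((hZs i _).1 (z i).2).1⟩) := by
  classical
  let inc : ∀ i, Zs i →L[ℂ] Z := fun i =>
    (Zs i).subtypeL.codRestrict Z fun z => ((hZs i _).1 z.2).1
  let proj : ∀ i, Z →L[ℂ] Zs i := fun i =>
    ((p i) ∘L Z.subtypeL).codRestrict (Zs i) fun z => (hZs i _).2 ⟨hZ i _ z.2, hp i _⟩
  have hinc : ∀ i, (Bs i).submoduleOf (Zs i) ≤ (B.submoduleOf Z).comap (inc i : Zs i →ₗ[ℂ] Z) :=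
    fun i x hx => hBs i hx
  have hproj : ∀ i, B.submoduleOf Z ≤ ((Bs i).submoduleOf (Zs i)).comap (proj i : Z →ₗ[ℂ] Zs i) :=
    fun i x hx => hB i _ hx
  let incQ : ∀ i, (Zs i ⧸ (Bs i).submoduleOf (Zs i)) →ₗ[ℂ] Z ⧸ B.submoduleOf Z := fun i =>
    Submodule.mapQ _ _ (inc i : Zs i →ₗ[ℂ] Z) (hinc i)
  let projQ : ∀ i, (Z ⧸ B.submoduleOf Z) →ₗ[ℂ] Zs i ⧸ (Bs i).submoduleOf (Zs i) := fun i =>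
    Submodule.mapQ _ _ (proj i : Z →ₗ[ℂ] Zs i) (hproj i)
  -- Continuity is that of a map out of a quotient topology, so `B` need not be closed and no open
  -- mapping argument is involved.
  have cinc : ∀ i, Continuous (incQ i) := fun i =>
    continuous_quot_lift _ (continuous_quot_mk.comp (inc i).continuous)
  have cproj : ∀ i, Continuous (projQ i) := fun i =>
    continuous_quot_lift _ (continuous_quot_mk.comp (proj i).continuous)
  let f : (∀ i, Zs i ⧸ (Bs i).submoduleOf (Zs i)) →ₗ[ℂ] Z ⧸ B.submoduleOf Z :=
    ∑ i, incQ i ∘ₗ LinearMap.proj i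
  have hf : ∀ z, f z = ∑ i, incQ i (z i) := fun z => by simp [f]
  have hfmk : ∀ z : ∀ i, Zs i, f (fun i => Submodule.Quotient.mk (z i))
      = Submodule.Quotient.mk (∑ i, inc i (z i)) := fun z => by
    rw [hf, ← Submodule.mkQ_apply, map_sum]
    rfl
  let g : (Z ⧸ B.submoduleOf Z) →ₗ[ℂ] ∀ i, Zs i ⧸ (Bs i).submoduleOf (Zs i) :=
    LinearMap.pi projQ
  have hgmk : ∀ z : Z, g (Submodule.Quotient.mk z) = fun i => Submodule.Quotient.mk (proj i z) :=
    fun z => rfl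
  have hgf : ∀ z, g (f z) = z := by
    intro z
    choose y hy using fun i => Submodule.Quotient.mk_surjective _ (z i)
    obtain rfl : (fun i => Submodule.Quotient.mk (y i)) = z := funext hy
    rw [hfmk, hgmk]
    funext i
    congr 1
    apply Subtype.ext
    have h1 : ((∑ j, inc j (y j) : Z) : E) = ∑ j, (y j : E) := by
      rw [Submodule.coe_sum]; rfl
    change p i ((∑ j, inc j (y j) : Z) : E) = y i
    rw [h1, map_sum, Finset.sum_eq_single i]
    · exact ((hZs i _).1 (y i).2).2
    · intro j _ hj
      -- Write `y j` as `p j (y j)`, which `p i` kills by orthogonality.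
      rw [← ((hZs j _).1 (y j).2).2, hpp i j _ hj.symm]
    · simp
  have hfg : ∀ z, f (g z) = z := by
    intro z
    obtain ⟨y, rfl⟩ := Submodule.Quotient.mk_surjective _ z
    rw [hgmk, hfmk]
    congr 1
    apply Subtype.ext
    rw [Submodule.coe_sum]
    exact hsum y
  have cf : Continuous f := by
    have : (f : (∀ i, Zs i ⧸ (Bs i).submoduleOf (Zs i)) → _) = fun z => ∑ i, incQ i (z i) :=
      funext hf
    rw [this]
    exact continuous_finsetSum _ fun i _ => (cinc i).comp (continuous_apply i)
  have cg : Continuous g := continuous_pi cproj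
  exact ⟨{ toFun := f, invFun := g, left_inv := hgf, right_inv := hfg, map_add' := f.map_add,
           map_smul' := f.map_smul, continuous_toFun := cf, continuous_invFun := cg }, hfmk⟩

/-! ### Complexes split by commuting families of projections. -/

variable {C : ℕ → Type*} [∀ n, NormedAddCommGroup (C n)] [∀ n, NormedSpace ℂ (C n)]

theorem apply_mem_cycles {d : ∀ n, C (n + 1) →L[ℂ] C n} {P : ∀ n, C n →L[ℂ] C n}
    (h : ∀ n, d n ∘L P (n + 1) = P n ∘L d n) (n : ℕ) {x : C n} (hx : x ∈ cycles d n) :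
    P n x ∈ cycles d n := by
  cases n with
  | zero => trivial
  | succ n =>
    have e := DFunLike.congr_fun (h n) x
    have hx' : d n x = 0 := hx
    change d n (P (n + 1) x) = 0
    exact e.trans (by simp [hx'])

theorem mem_range_iff_of_idempotent {E : Type*} [NormedAddCommGroup E] [NormedSpace ℂ E]
    {p : E →L[ℂ] E} (hp : p ∘L p = p) (x : E) : x ∈ p.range ↔ p x = x := by
  constructor
  · rintro ⟨y, rfl⟩
    exact DFunLike.congr_fun hp y
  · intro h
    exact ⟨x, h⟩

theorem exists_homology_equiv (d : ∀ n, C (n + 1) →L[ℂ] C n) (P : ∀ n, ℕ → C n →L[ℂ] C n)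
    (I : Finset ℕ) (n : ℕ) (hP : ∀ n i, P n i ∘L P n i = P n i)
    (hPP : ∀ n i j, i ≠ j → P n i ∘L P n j = 0)
    (hd : ∀ n i, d n ∘L P (n + 1) i = P n i ∘L d n)
    (hsum : ∑ i ∈ I, P n i = ContinuousLinearMap.id ℂ (C n)) :
    ∃ Φ : (∀ i : I, SubHomologyOf d (fun m => (P m i).range) n) ≃L[ℂ] HomologyOf d n,
      ∀ z : ∀ i : I, subCycles d (fun m => (P m i).range) n,
        Φ (fun i => Submodule.Quotient.mk (z i))
          = Submodule.Quotient.mk (∑ i, ⟨(z i : C n), (z i).2.1⟩) := by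
  refine exists_subquotient_equiv (fun i : I => P n i)
    (fun i x => DFunLike.congr_fun (hP n i) x)
    (fun i j x hij => DFunLike.congr_fun (hPP n i j fun e => hij (Subtype.ext e)) x)
    (fun x => ?_) (cycles d n) (boundaries d n)
    (fun i => subCycles d (fun m => (P m i).range) n)
    (fun i => subBoundaries d (fun m => (P m i).range) n)
    (fun i x => and_congr_right fun _ => mem_range_iff_of_idempotent (hP n i) x)
    (fun i x hx => apply_mem_cycles (P := fun m => P m i) (fun m => hd m i) n hx)
    (fun i => ?_) (fun i => ?_)
  · have := DFunLike.congr_fun hsum x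
    rw [_root_.sum_apply, ← Finset.sum_coe_sort] at this
    exact this
  · rintro _ ⟨y, -, rfl⟩
    exact ⟨y, rfl⟩
  · rintro _ ⟨y, rfl⟩
    -- A component of the boundary of `y` is the boundary of the same component of `y`, hence a
    -- boundary within the subcomplex.
    exact ⟨P (n + 1) i y, ⟨y, rfl⟩, DFunLike.congr_fun (hd n i) y⟩

theorem exists_cohomology_equiv (δ : ∀ n, C n →L[ℂ] C (n + 1)) (Q : ∀ n, ℕ → C n →L[ℂ] C n)
    (I : Finset ℕ) (n : ℕ) (hQ : ∀ n i, Q n i ∘L Q n i = Q n i)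
    (hQQ : ∀ n i j, i ≠ j → Q n i ∘L Q n j = 0)
    (hδ : ∀ n i, δ n ∘L Q n i = Q (n + 1) i ∘L δ n)
    (hsum : ∑ i ∈ I, Q n i = ContinuousLinearMap.id ℂ (C n)) :
    ∃ Φ : (∀ i : I, SubCohomologyOf δ (fun m => (Q m i).range) n) ≃L[ℂ] CohomologyOf δ n,
      ∀ z : ∀ i : I, subCocycles δ (fun m => (Q m i).range) n,
        Φ (fun i => Submodule.Quotient.mk (z i))
          = Submodule.Quotient.mk (∑ i, ⟨(z i : C n), (z i).2.1⟩) := by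
  refine exists_subquotient_equiv (fun i : I => Q n i)
    (fun i x => DFunLike.congr_fun (hQ n i) x)
    (fun i j x hij => DFunLike.congr_fun (hQQ n i j fun e => hij (Subtype.ext e)) x)
    (fun x => ?_) (cocycles δ n) (coboundaries δ n)
    (fun i => subCocycles δ (fun m => (Q m i).range) n)
    (fun i => subCoboundaries δ (fun m => (Q m i).range) n)
    (fun i x => and_congr_right fun _ => mem_range_iff_of_idempotent (hQ n i) x)
    (fun i x hx => ?_) (fun i => ?_) (fun i => ?_)
  · have := DFunLike.congr_fun hsum x
    rw [_root_.sum_apply, ← Finset.sum_coe_sort] at this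
    exact this
  · have hx' : δ n x = 0 := hx
    change δ n (Q n i x) = 0
    exact (DFunLike.congr_fun (hδ n i) x).trans (by simp [hx'])
  · cases n with
    | zero => exact le_rfl
    | succ n =>
      rintro _ ⟨y, -, rfl⟩
      exact ⟨y, rfl⟩
  · cases n with
    | zero =>
      intro x hx
      obtain rfl : x = 0 := hx
      simp
    | succ n =>
      rintro _ ⟨y, rfl⟩
      exact ⟨Q n i y, ⟨y, rfl⟩, DFunLike.congr_fun (hδ n i) y⟩

end Decomposition

theorem corollary3p3 {A M : Type*} [NonUnitalNormedCommRing A] [NormedSpace ℂ A]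
    [IsScalarTower ℂ A A] [SMulCommClass ℂ A A] [CompleteSpace A]
    [NormedAddCommGroup M] [NormedSpace ℂ M] [CompleteSpace M]
    (X : BanachBimodule A M) (hX : X.IsSymmetric) :
    -- homology
    ((∀ n, Hochschild.boundary X n ∘L Hochschild.boundary X (n + 1) = 0) ∧
      (∀ n i, Hochschild.chainBGS A M n i ∘L Hochschild.chainBGS A M n i
        = Hochschild.chainBGS A M n i) ∧
      (∀ n i, Hochschild.boundary X n ∘L Hochschild.chainBGS A M (n + 1) i
        = Hochschild.chainBGS A M n i ∘L Hochschild.boundary X n) ∧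
      (∀ n i j, i ≠ j →
        Hochschild.chainBGS A M n i ∘L Hochschild.chainBGS A M n j = 0) ∧
      (∀ n i, i ∉ bgsIndex n → Hochschild.chainBGS A M n i = 0) ∧
      (∀ n, ∑ i ∈ bgsIndex n, Hochschild.chainBGS A M n i
        = ContinuousLinearMap.id ℂ (Hochschild.Chain A M n)) ∧
      (∀ n, ∃ Φ : (∀ i : bgsIndex n, SubHomologyOf (Hochschild.boundary X)
            (Hochschild.chainSummand A M i) n)
          ≃L[ℂ] HomologyOf (Hochschild.boundary X) n,
        ∀ (z : ∀ i : bgsIndex n, subCycles (Hochschild.boundary X)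
            (Hochschild.chainSummand A M i) n),
          Φ (fun i => Submodule.Quotient.mk (z i))
            = Submodule.Quotient.mk (∑ i, ⟨(z i : Hochschild.Chain A M n), (z i).2.1⟩))) ∧
    -- cohomology
    ((∀ n, Hochschild.coboundary X (n + 1) ∘L Hochschild.coboundary X n = 0) ∧
      (∀ n i, Hochschild.cochainBGS A M n i ∘L Hochschild.cochainBGS A M n i
        = Hochschild.cochainBGS A M n i) ∧
      (∀ n i, Hochschild.coboundary X n ∘L Hochschild.cochainBGS A M n i
        = Hochschild.cochainBGS A M (n + 1) i ∘L Hochschild.coboundary X n) ∧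
      (∀ n i j, i ≠ j →
        Hochschild.cochainBGS A M n i ∘L Hochschild.cochainBGS A M n j = 0) ∧
      (∀ n i, i ∉ bgsIndex n → Hochschild.cochainBGS A M n i = 0) ∧
      (∀ n, ∑ i ∈ bgsIndex n, Hochschild.cochainBGS A M n i
        = ContinuousLinearMap.id ℂ (Hochschild.Cochain A M n)) ∧
      (∀ n, ∃ Φ : (∀ i : bgsIndex n, SubCohomologyOf (Hochschild.coboundary X)
            (Hochschild.cochainSummand A M i) n)
          ≃L[ℂ] CohomologyOf (Hochschild.coboundary X) n,
        ∀ (z : ∀ i : bgsIndex n, subCocycles (Hochschild.coboundary X)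
            (Hochschild.cochainSummand A M i) n),
          Φ (fun i => Submodule.Quotient.mk (z i))
            = Submodule.Quotient.mk (∑ i, ⟨(z i : Hochschild.Cochain A M n), (z i).2.1⟩))) :=
  ⟨⟨Hochschild.boundary_comp_boundary X hX, Hochschild.chainBGS_comp_self,
    Hochschild.boundary_comp_chainBGS X hX, fun n _ _ h => Hochschild.chainBGS_comp_of_ne n h,
    fun _ _ h => Hochschild.chainBGS_of_notMem h, Hochschild.sum_chainBGS,
    fun n => exists_homology_equiv (Hochschild.boundary X) (Hochschild.chainBGS A M) (bgsIndex n) n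
      Hochschild.chainBGS_comp_self (fun n _ _ h => Hochschild.chainBGS_comp_of_ne n h)
      (Hochschild.boundary_comp_chainBGS X hX) (Hochschild.sum_chainBGS n)⟩,
  Hochschild.coboundary_comp_coboundary X hX, Hochschild.cochainBGS_comp_self,
    Hochschild.coboundary_comp_cochainBGS X hX,
    fun n _ _ h => Hochschild.cochainBGS_comp_of_ne n h,
    fun _ _ h => Hochschild.cochainBGS_of_notMem h, Hochschild.sum_cochainBGS,
    fun n => exists_cohomology_equiv (Hochschild.coboundary X) (Hochschild.cochainBGS A M)
      (bgsIndex n) n Hochschild.cochainBGS_comp_self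
      (fun n _ _ h => Hochschild.cochainBGS_comp_of_ne n h)
      (Hochschild.coboundary_comp_cochainBGS X hX) (Hochschild.sum_cochainBGS n)⟩
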